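/- Let $m\le n$. Equip $\mathbb R^m$ with its standard inner product and the space $\mathbf M^{n\times m}$ of real $n\times m$ matrices with the trace inner product $\langle X,Y\rangle=\operatorname{tr}(X^TY)$. For $X\in\mathbf M^{n\times m}$ let $\sigma(X)=(\sigma_1(X),\dots,\sigma_m(X))\in\mathbb R^m$ be the vector of singular values of $X$ (the square roots of the eigenvalues of $X^TX$) in nonincreasing order, and for $v\in\mathbb R^m$ let $\operatorname{Diag}v$ be the $n\times m$ matrix with $v$ on its main diagonal and zeros elsewhere. Let $\mathbf E$ be a Euclidean space and $g\colon\mathbf E\to[-\infty,+\infty]$, with $\operatorname{dom}g=\{x: g(x)<+\infty\}$. If $g(x)$ is finite, the Fréchet subdifferential $\hat\partial g(x)$ is the set of all $v\in\mathbf E$ with $g(y)\ge g(x)+\langle v,y-x\rangle+o(\|y-x\|)$ as $y\to x$, and the limiting subdifferential $\partial g(x)$ is the set of all limits $v=\lim v_i$ with $v_i\in\hat\partial g(x_i)$, $x_i\to x$ and $g(x_i)\to g(x)$; both sets are empty if $g(x)$ is infinite. A set $M\subset\operatorname{dom}g$ is called identifiable (relative to $g$) at $x$ for $v$ if $v\in\partial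 g(x)$ and, for all sequences $(x_i,g(x_i),v_i)\to(x,g(x),v)$ with $v_i\in\partial g(x_i)$, one has $x_i\in M$ for all sufficiently large $i$. A function $f$ on $\mathbb R^m$ is locally absolutely permutation-invariant around $\bar x$ if, for every signed permutation $\tau$ of the coordinates with $\tau\bar x=\bar x$, one has $f(\tau x)=f(x)$ for all $x$ near $\bar x$; a set $M\subset\mathbb R^m$ has this property if its indicator function does, that is, $\tau x\in M\Leftrightarrow x\in M$ for all $x$ near $\bar x$. **Proposition.** Let $f\colon\mathbb R^m\to[-\infty,+\infty]$ be lower semicontinuous, let $\bar X\in\mathbf M^{n\times m}$ and put $\bar x:=\sigma(\bar X)$. Suppose that $f$ and a set $M\subset\operatorname{dom}f$ are locally absolutely permutation-invariant around $\bar x$. Let $\bar v\in\mathbb R^m$, and let $U\in\mathbf M^{n\times n}$ and $V\in\mathbf M^{m\times m}$ be any orthogonal matrices with $\bar X=U^T(\operatorname{Diag}\sigma(\bar X))V$. Then $M$ is identifiable (relative to $f$) at $\bar x$ for $\bar v$ if and only if $\sigma^{-1}(M)$ is identifiable (relative to $f\circ\sigma$) at $\bar X$ for $U^T(\operatorname{Diag}\bar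 v)V$. -/

import Mathlib

open Filter Topology

/-! ### Subdifferentials and identifiable sets in a Euclidean space -/

section Variational

variable {E : Type*} [NormedAddCommGroup E] [InnerProductSpace ℝ E]

/-- The domain `{x : f x < +∞}` of an extended-real-valued function. -/
def effDomain (f : E → EReal) : Set E := {x | f x < ⊤}

/-- The Fréchet subdifferential of `f` at `x`: if `f x` is finite, it consists of all `v` with
`f y ≥ f x + ⟪v, y - x⟫ + o(‖y - x‖)` as `y → x`; otherwise it is empty. -/
def frechetSubdiff (f : E → EReal) (x : E) : Set E :=
  {v | f x ≠ ⊥ ∧ f x ≠ ⊤ ∧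
    ∀ ε : ℝ, 0 < ε → ∀ᶠ y in 𝓝 x,
      f x + ((inner ℝ v (y - x) - ε * ‖y - x‖ : ℝ) : EReal) ≤ f y}

/-- The limiting subdifferential of `f` at `x`: if `f x` is finite, it consists of all limits `v`
of Fréchet subgradients `vᵢ` of `f` at points `xᵢ` with `(xᵢ, f xᵢ) → (x, f x)`; otherwise it is
empty. -/
def limitingSubdiff (f : E → EReal) (x : E) : Set E :=
  {v | f x ≠ ⊥ ∧ f x ≠ ⊤ ∧ ∃ (xs vs : ℕ → E),
    (∀ i, vs i ∈ frechetSubdiff f (xs i)) ∧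
    Tendsto xs atTop (𝓝 x) ∧ Tendsto (fun i => f (xs i)) atTop (𝓝 (f x)) ∧
    Tendsto vs atTop (𝓝 v)}

/-- `M ⊆ dom f` is identifiable (relative to `f`) at `x` for the limiting subgradient `v`. -/
structure IsIdentifiableAt (f : E → EReal) (M : Set E) (x v : E) : Prop where
  subset_domain : M ⊆ effDomain f
  mem_subdiff : v ∈ limitingSubdiff f x
  eventually_mem : ∀ xs vs : ℕ → E, (∀ i, vs i ∈ limitingSubdiff f (xs i)) →
    Tendsto xs atTop (𝓝 x) → Tendsto (fun i => f (xs i)) atTop (𝓝 (f x)) →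
    Tendsto vs atTop (𝓝 v) → ∀ᶠ i in atTop, xs i ∈ M

end Variational

/-! ### Absolute permutation invariance -/

/-- The signed permutation of coordinates given by the permutation `π` and the signs `s`. -/
def signedPerm {m : ℕ} (π : Equiv.Perm (Fin m)) (s : Fin m → ℤˣ)
    (x : EuclideanSpace ℝ (Fin m)) : EuclideanSpace ℝ (Fin m) :=
  WithLp.toLp 2 fun i => ((s i : ℤ) : ℝ) * x (π i)

/-- `f` is locally absolutely permutation-invariant around `x₀`. -/
def LocallyAbsPermInvariant {m : ℕ} (f : EuclideanSpace ℝ (Fin m) → EReal)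
    (x₀ : EuclideanSpace ℝ (Fin m)) : Prop :=
  ∀ (π : Equiv.Perm (Fin m)) (s : Fin m → ℤˣ), signedPerm π s x₀ = x₀ →
    ∀ᶠ x in 𝓝 x₀, f (signedPerm π s x) = f x

/-- The set `M` is locally absolutely permutation-invariant around `x₀`; equivalently, its
indicator function is. -/
def SetLocallyAbsPermInvariant {m : ℕ} (M : Set (EuclideanSpace ℝ (Fin m)))
    (x₀ : EuclideanSpace ℝ (Fin m)) : Prop :=
  ∀ (π : Equiv.Perm (Fin m)) (s : Fin m → ℤˣ), signedPerm π s x₀ = x₀ →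
    ∀ᶠ x in 𝓝 x₀, (signedPerm π s x ∈ M ↔ x ∈ M)

/-! ### Rectangular matrices with the trace inner product, and singular values -/

attribute [local instance] Matrix.frobeniusNormedAddCommGroup Matrix.frobeniusNormedSpace

/-- The trace inner product `⟪X, Y⟫ = tr (Xᵀ Y)`, whose norm is the Frobenius norm. -/
noncomputable instance matrixTraceInner {n m : ℕ} :
    InnerProductSpace ℝ (Matrix (Fin n) (Fin m) ℝ) where
  inner X Y := (X.transpose * Y).trace
  norm_sq_eq_re_inner X := by
    rw [Matrix.frobenius_norm_def, ← Real.sqrt_eq_rpow, Real.sq_sqrt (by positivity)]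
    simp only [Matrix.trace, Matrix.diag_apply, Matrix.mul_apply, Matrix.transpose_apply,
      RCLike.re_to_real]
    rw [Finset.sum_comm]
    simp [sq]
  conj_inner_symm X Y := by
    rw [← Matrix.trace_transpose (X.transpose * Y)]
    simp [Matrix.transpose_mul]
  add_left X Y Z := by simp [Matrix.add_mul]
  smul_left X Y r := by simp

/-- The vector `(σ₁(X), …, σₘ(X))` of singular values of an `n × m` matrix `X` (the square roots
of the eigenvalues of `Xᵀ X`) in nonincreasing order. -/
noncomputable def singularValueMap {n m : ℕ} (X : Matrix (Fin n) (Fin m) ℝ) :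
    EuclideanSpace ℝ (Fin m) :=
  WithLp.toLp 2 fun i => (Matrix.toEuclideanLin X).singularValues i

/-- The `n × m` matrix with the entries of `v` on its main diagonal and zeros elsewhere. -/
def rectDiag (n : ℕ) {m : ℕ} (v : EuclideanSpace ℝ (Fin m)) : Matrix (Fin n) (Fin m) ℝ :=
  Matrix.of fun i j => if (i : ℕ) = (j : ℕ) then v j else 0

/-! Local invariance is first made global. Let `g` send a vector to its absolute values in
nonincreasing order, that is, `g x = σ(Diag x)`. Near `σ(X₀)` only signed permutations fixing
`σ(X₀)` can sort a vector, so `f` and `M` agree there with `f ∘ g` and `g ⁻¹' M`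
(`eventually_signedPerm_fixes`). Since `g ∘ σ = σ`, the matrix side does not change at all.

For globally invariant data, subgradients are compared along the isometric embeddings `x ↦ Uᵀ (Diag
x) V`. Lifting from vectors to matrices (`svdEmbedding_mem_frechetSubdiff`) rests on von Neumann's
trace inequality, applied at `x + δ v` with `δ > 0` such that one signed permutation sorts both `x`
and `x + δ v`.

Conversely, `f ∘ σ` is constant on orbits of the orthogonal groups, so a Fréchet subgradient `Z` at
`X` is tested against the tangent vectors `A X` and `X B` with `A`, `B` skew. This makes `X Zᵀ` and
`Zᵀ X` symmetric, which forces a simultaneous singular value decomposition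
(`exists_simultaneous_svd`), and the subgradient inequality restricts to the embedded vectors.
Compactness of the orthogonal groups carries this over to limiting subgradients.

The orthogonal matrices found this way need not be the given `U` and `V`. But two simultaneous
decompositions of one pair have coefficient vectors that differ by a common signed permutation
(`exists_signedPerm_eq_of_svdEmbedding_eq`), which is a symmetry of `f` and `M`. Hence convergent
sequences on one side yield convergent sequences on the other. -/

/-! ### Singular values through the characteristic polynomial of `Xᵀ X` -/

open Matrix in
lemma adjoint_comp_toEuclideanLin {n m : ℕ} (A : Matrix (Fin n) (Fin m) ℝ) :
    LinearMap.adjoint (toEuclideanLin A) ∘ₗ toEuclideanLin A = toEuclideanLin (Aᵀ * A) := by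
  rw [← toEuclideanLin_conjTranspose_eq_adjoint]
  ext x : 1
  simp [toEuclideanLin, toLpLin_apply, Matrix.conjTranspose_eq_transpose_of_trivial]

open Matrix in
lemma charpoly_toEuclideanLin {m : ℕ} (A : Matrix (Fin m) (Fin m) ℝ) :
    (toEuclideanLin A).charpoly = A.charpoly := by
  rw [toEuclideanLin_eq_toLin_orthonormal, charpoly_toLin]

-- The ordered eigenvalues of a symmetric operator are determined by its characteristic polynomial.
-- All later invariance properties of `σ` reduce to this criterion.
open Matrix in
lemma singularValueMap_eq_of_charpoly {n n' m : ℕ} {A : Matrix (Fin n) (Fin m) ℝ}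
    {B : Matrix (Fin n') (Fin m) ℝ} (h : (Aᵀ * A).charpoly = (Bᵀ * B).charpoly) :
    singularValueMap A = singularValueMap B := by
  ext i
  have hn : Module.finrank ℝ (EuclideanSpace ℝ (Fin m)) = m := by simp
  simp only [singularValueMap]
  rw [LinearMap.singularValues_fin _ hn, LinearMap.singularValues_fin _ hn]
  have h2 := ((toEuclideanLin A).isSymmetric_adjoint_comp_self.eigenvalues_eq_eigenvalues_iff hn
    (toEuclideanLin B).isSymmetric_adjoint_comp_self hn).2 <| by
      rw [adjoint_comp_toEuclideanLin, adjoint_comp_toEuclideanLin, charpoly_toEuclideanLin,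
        charpoly_toEuclideanLin, h]
  rw [h2]

open Matrix in
lemma roots_charpoly_transpose_mul_self {n m : ℕ} (A : Matrix (Fin n) (Fin m) ℝ) :
    (Aᵀ * A).charpoly.roots = Finset.univ.val.map fun i => singularValueMap A i ^ 2 := by
  have hn : Module.finrank ℝ (EuclideanSpace ℝ (Fin m)) = m := by simp
  rw [← charpoly_toEuclideanLin, ← adjoint_comp_toEuclideanLin,
    (toEuclideanLin A).isSymmetric_adjoint_comp_self.roots_charpoly_eq_eigenvalues hn]
  congr 1
  ext i
  simp [singularValueMap, LinearMap.sq_singularValues_fin _ hn]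

lemma singularValueMap_nonneg {n m : ℕ} (A : Matrix (Fin n) (Fin m) ℝ) (i : Fin m) :
    0 ≤ singularValueMap A i :=
  LinearMap.singularValues_nonneg _ _

lemma singularValueMap_antitone {n m : ℕ} (A : Matrix (Fin n) (Fin m) ℝ) :
    Antitone fun i => singularValueMap A i :=
  fun _ _ h => LinearMap.singularValues_antitone _ h

open Matrix in
lemma singularValueMap_orthogonal_mul_mul {n m : ℕ} {U : Matrix (Fin n) (Fin n) ℝ}
    (hU : U ∈ orthogonalGroup (Fin n) ℝ) {V : Matrix (Fin m) (Fin m) ℝ}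
    (hV : V ∈ orthogonalGroup (Fin m) ℝ) (A : Matrix (Fin n) (Fin m) ℝ) :
    singularValueMap (U * A * V) = singularValueMap A := by
  apply singularValueMap_eq_of_charpoly
  have hU' : Uᵀ * U = 1 := (mem_orthogonalGroup_iff' _ _).1 hU
  have hV' : V * Vᵀ = 1 := (mem_orthogonalGroup_iff _ _).1 hV
  have : (U * A * V)ᵀ * (U * A * V) = Vᵀ * (Aᵀ * A * V) := by
    simp only [transpose_mul, Matrix.mul_assoc]
    rw [← Matrix.mul_assoc Uᵀ, hU', Matrix.one_mul]
  rw [this, charpoly_mul_comm, Matrix.mul_assoc, hV', Matrix.mul_one]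

open Matrix in
lemma transpose_rectDiag_mul_rectDiag {n m : ℕ} (hmn : m ≤ n) (x y : EuclideanSpace ℝ (Fin m)) :
    (rectDiag n x)ᵀ * rectDiag n y = diagonal fun i => x i * y i := by
  ext i j
  simp only [rectDiag, mul_apply, transpose_apply, of_apply, diagonal_apply]
  rw [Finset.sum_eq_single (Fin.castLE hmn i)]
  · by_cases h : i = j
    · simp [h]
    · have : (i : ℕ) ≠ j := fun h' => h (Fin.ext h')
      simp [h, this]
  · intro k _ hk
    have : (k : ℕ) ≠ i := fun h' => hk (Fin.ext h')
    simp [this]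
  · simp

open Matrix in
lemma roots_charpoly_rectDiag {n m : ℕ} (hmn : m ≤ n) (x : EuclideanSpace ℝ (Fin m)) :
    ((rectDiag n x)ᵀ * rectDiag n x).charpoly.roots = Finset.univ.val.map fun i => x i ^ 2 := by
  rw [transpose_rectDiag_mul_rectDiag hmn, charpoly_diagonal, Polynomial.roots_prod _ _
    (Finset.prod_ne_zero_iff.2 fun i _ => Polynomial.X_sub_C_ne_zero _)]
  simp only [Polynomial.roots_X_sub_C, sq]
  exact Multiset.bind_singleton _ _

/-! ### Signed permutations of coordinates -/

/-- Counting multiplicities shows that corresponding fibres of `f` and `g` have equal size;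
bijections between them glue to a permutation. -/
lemma exists_perm_of_map_univ_eq {ι α : Type*} [Fintype ι] {f g : ι → α}
    (h : Finset.univ.val.map f = Finset.univ.val.map g) : ∃ π : Equiv.Perm ι, f = g ∘ π := by
  classical
  have hc : ∀ a, Fintype.card {i // f i = a} = Fintype.card {i // g i = a} := by
    intro a
    have := congrArg (Multiset.count a) h
    rw [Multiset.count_map, Multiset.count_map] at this
    rw [Fintype.card_subtype, Fintype.card_subtype]
    simpa [Finset.card_def, eq_comm] using this
  let e : ∀ a, {i // f i = a} ≃ {i // g i = a} := fun a => Fintype.equivOfCardEq (hc a)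
  refine ⟨(Equiv.sigmaFiberEquiv f).symm.trans ((Equiv.sigmaCongrRight e).trans
    (Equiv.sigmaFiberEquiv g)), ?_⟩
  ext i
  exact ((e (f i)) ⟨i, rfl⟩).2.symm

lemma exists_signedPerm_of_roots {m : ℕ} {x y : EuclideanSpace ℝ (Fin m)}
    (h : Finset.univ.val.map (fun i => x i ^ 2) = Finset.univ.val.map (fun i => y i ^ 2)) :
    ∃ π s, x = signedPerm π s y := by
  obtain ⟨π, hπ⟩ := exists_perm_of_map_univ_eq h
  have h1 : ∀ i, ∃ s : ℤˣ, x i = ((s : ℤ) : ℝ) * y (π i) := by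
    intro i
    rcases sq_eq_sq_iff_eq_or_eq_neg.1 (congrFun hπ i) with h | h
    · exact ⟨1, by simpa using h⟩
    · exact ⟨-1, by simpa using h⟩
  choose s hs using h1
  exact ⟨π, s, by ext i; exact hs i⟩

lemma exists_singularValueMap_rectDiag {n m : ℕ} (hmn : m ≤ n) (x : EuclideanSpace ℝ (Fin m)) :
    ∃ π s, singularValueMap (rectDiag n x) = signedPerm π s x :=
  exists_signedPerm_of_roots <| by
    rw [← roots_charpoly_transpose_mul_self, roots_charpoly_rectDiag hmn]

lemma signedPerm_sq {m : ℕ} (π : Equiv.Perm (Fin m)) (s : Fin m → ℤˣ)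
    (x : EuclideanSpace ℝ (Fin m)) (i : Fin m) : signedPerm π s x i ^ 2 = x (π i) ^ 2 := by
  rcases Int.units_eq_one_or (s i) with h | h <;> simp [signedPerm, h]

open Matrix in
lemma singularValueMap_rectDiag_signedPerm {n m : ℕ} (hmn : m ≤ n) (π : Equiv.Perm (Fin m))
    (s : Fin m → ℤˣ) (x : EuclideanSpace ℝ (Fin m)) :
    singularValueMap (rectDiag n (signedPerm π s x)) = singularValueMap (rectDiag n x) := by
  apply singularValueMap_eq_of_charpoly
  rw [transpose_rectDiag_mul_rectDiag hmn, transpose_rectDiag_mul_rectDiag hmn, charpoly_diagonal,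
    charpoly_diagonal]
  simp only [← sq, signedPerm_sq]
  exact Equiv.prod_comp π fun i => Polynomial.X - Polynomial.C (x i ^ 2)

/-- A signed permutation of the coordinates as a linear isometry. -/
noncomputable def signedPermIsometry {m : ℕ} (π : Equiv.Perm (Fin m)) (s : Fin m → ℤˣ) :
    EuclideanSpace ℝ (Fin m) ≃ₗᵢ[ℝ] EuclideanSpace ℝ (Fin m) :=
  LinearIsometry.toLinearIsometryEquiv
    { toFun := signedPerm π s
      map_add' := fun x y => by ext i; simp [signedPerm, mul_add]
      map_smul' := fun r x => by ext i; simp [signedPerm]; ring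
      norm_map' := fun x => by
        simp only [LinearMap.coe_mk, AddHom.coe_mk, EuclideanSpace.norm_eq, Real.norm_eq_abs,
          sq_abs, signedPerm_sq]
        rw [Equiv.sum_comp π fun i => x i ^ 2] } rfl

@[simp] lemma signedPermIsometry_apply {m : ℕ} (π : Equiv.Perm (Fin m)) (s : Fin m → ℤˣ)
    (x : EuclideanSpace ℝ (Fin m)) : signedPermIsometry π s x = signedPerm π s x := rfl

/-! ### Simultaneous singular value decomposition -/

/-- The joint eigenspaces of commuting symmetric operators form an orthogonal direct sum. Only
finitely many are nonzero, so an orthonormal basis subordinate to those can be chosen. -/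
lemma exists_orthonormalBasis_joint_eigenvectors {E ι : Type*} [NormedAddCommGroup E]
    [InnerProductSpace ℝ E] [FiniteDimensional ℝ E] {m : ℕ} (hm : Module.finrank ℝ E = m)
    (T : ι → E →ₗ[ℝ] E) (hT : ∀ i, (T i).IsSymmetric) (hC : ∀ i j, Commute (T i) (T j)) :
    ∃ b : OrthonormalBasis (Fin m) ℝ E, ∀ i j, ∃ c : ℝ, T i (b j) = c • b j := by
  classical
  let W : (ι → ℝ) → Submodule ℝ E := fun γ => ⨅ j, Module.End.eigenspace (T j) (γ j)
  have hI : DirectSum.IsInternal W :=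
    LinearMap.IsSymmetric.directSum_isInternal_of_pairwise_commute hT fun i j _ => hC i j
  have hO := LinearMap.IsSymmetric.orthogonalFamily_iInf_eigenspaces hT
  have hI' := DirectSum.isInternal_ne_bot_iff.2 hI
  have hfin : {γ | W γ ≠ ⊥}.Finite :=
    WellFoundedGT.finite_ne_bot_of_iSupIndep hI.submodule_iSupIndep
  have : Fintype {γ // W γ ≠ ⊥} := hfin.fintype
  have hO' : OrthogonalFamily ℝ (fun γ : {γ // W γ ≠ ⊥} => W γ) fun γ => (W γ).subtypeₗᵢ :=
    hO.comp Subtype.val_injective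
  refine ⟨hI'.subordinateOrthonormalBasis hm hO', fun i j => ?_⟩
  have h := hI'.subordinateOrthonormalBasis_subordinate hm j hO'
  have h2 := (Submodule.mem_iInf _).1 h i
  exact ⟨_, Module.End.mem_eigenspace_iff.1 h2⟩

/-- Pairwise orthogonal families `x`, `z` with `x j` parallel to `z j` are multiples of a common
orthonormal basis. -/
lemma exists_orthonormalBasis_of_parallel {F : Type*} [NormedAddCommGroup F]
    [InnerProductSpace ℝ F] {n m : ℕ} (hmn : m ≤ n) (hF : Module.finrank ℝ F = n)
    [FiniteDimensional ℝ F] (x z : Fin m → F)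
    (hxx : ∀ i j, i ≠ j → inner ℝ (x i) (x j) = 0) (hxz : ∀ i j, i ≠ j → inner ℝ (x i) (z j) = 0)
    (hzz : ∀ i j, i ≠ j → inner ℝ (z i) (z j) = 0)
    (hpar : ∀ j, |inner ℝ (x j) (z j)| = ‖x j‖ * ‖z j‖) :
    ∃ (u : OrthonormalBasis (Fin n) ℝ F) (a b : Fin m → ℝ),
      ∀ j, x j = a j • u (Fin.castLE hmn j) ∧ z j = b j • u (Fin.castLE hmn j) := by
  classical
  have hzx : ∀ i j, i ≠ j → inner ℝ (z i) (x j) = 0 := fun i j h => by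
    rw [real_inner_comm]; exact hxz j i h.symm
  -- `w j` spans the line containing both `x j` and `z j`; it vanishes only if both do.
  let w : Fin m → F := fun j => if x j = 0 then z j else x j
  have hx : ∀ j, ∃ a : ℝ, x j = a • w j := by
    intro j
    by_cases h : x j = 0
    · exact ⟨0, by simp [h]⟩
    · exact ⟨1, by simp [w, h]⟩
  have hz : ∀ j, ∃ a : ℝ, z j = a • w j := by
    intro j
    by_cases h : x j = 0
    · exact ⟨1, by simp [w, h]⟩
    · by_cases h' : z j = 0
      · exact ⟨0, by simp [h']⟩
      have := (abs_real_inner_div_norm_mul_norm_eq_one_iff (x j) (z j)).1 (by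
        rw [abs_div, hpar, abs_of_nonneg (by positivity : 0 ≤ ‖x j‖ * ‖z j‖)]
        exact div_self (mul_ne_zero (norm_ne_zero_iff.2 h) (norm_ne_zero_iff.2 h')))
      obtain ⟨-, r, -, hr⟩ := this
      exact ⟨r, by simp [w, h, hr]⟩
  have hww : ∀ i j, i ≠ j → inner ℝ (w i) (w j) = 0 := by
    intro i j hij
    simp only [w]
    split_ifs
    exacts [hzz i j hij, hzx i j hij, hxz i j hij, hxx i j hij]
  let v : Fin n → F := fun k => if h : (k : ℕ) < m then (‖w ⟨k, h⟩‖⁻¹ : ℝ) • w ⟨k, h⟩ else 0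
  -- Only the nonzero directions are prescribed; the other basis vectors are free, and there the
  -- coefficients will be zero.
  let s : Set (Fin n) := {k | ∃ h : (k : ℕ) < m, w ⟨k, h⟩ ≠ 0}
  have hv : Orthonormal ℝ (fun k : s => v k) := by
    constructor
    · rintro ⟨k, h, hk⟩
      simp [v, h, norm_smul, hk]
    · rintro ⟨k, h, hk⟩ ⟨l, h', hl⟩ hkl
      have hne : (⟨k, h⟩ : Fin m) ≠ ⟨l, h'⟩ := fun h =>
        hkl (Subtype.ext (Fin.ext (congrArg (fun i : Fin m => (i : ℕ)) h)))
      simp only [v, h, h', dif_pos, inner_smul_left, inner_smul_right]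
      rw [hww _ _ hne]
      simp
  obtain ⟨u, hu⟩ := Orthonormal.exists_orthonormalBasis_extension_of_card_eq
    (show Module.finrank ℝ F = Fintype.card (Fin n) by simp [hF]) (v := v) (s := s) hv
  have hwu : ∀ j, w j = ‖w j‖ • u (Fin.castLE hmn j) := by
    intro j
    by_cases h : w j = 0
    · simp [h]
    · rw [hu (Fin.castLE hmn j) ⟨j.2, h⟩]
      simp [v, smul_smul, h]
  choose a ha using hx
  choose b hb using hz
  refine ⟨u, fun j => a j * ‖w j‖, fun j => b j * ‖w j‖, fun j => ⟨?_, ?_⟩⟩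
  · rw [mul_smul, ← hwu, ← ha]
  · rw [mul_smul, ← hwu, ← hb]

open Matrix in
/-- The matrix whose rows are the vectors of an orthonormal basis is orthogonal. -/
lemma of_orthonormalBasis_mem_orthogonalGroup {n : ℕ}
    (u : OrthonormalBasis (Fin n) ℝ (EuclideanSpace ℝ (Fin n))) :
    (Matrix.of fun i j => u i j) ∈ orthogonalGroup (Fin n) ℝ := by
  rw [mem_orthogonalGroup_iff]
  ext i j
  have := orthonormal_iff_ite.1 u.orthonormal j i
  rw [PiLp.inner_apply] at this
  simpa [mul_apply, one_apply, eq_comm] using this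

open Matrix in
lemma eq_transpose_mul_rectDiag_mul {n m : ℕ} (hmn : m ≤ n) (X : Matrix (Fin n) (Fin m) ℝ)
    (u : OrthonormalBasis (Fin n) ℝ (EuclideanSpace ℝ (Fin n)))
    (e : OrthonormalBasis (Fin m) ℝ (EuclideanSpace ℝ (Fin m))) (a : Fin m → ℝ)
    (h : ∀ j, toEuclideanLin X (e j) = a j • u (Fin.castLE hmn j)) :
    X = (Matrix.of fun i j => u i j)ᵀ * rectDiag n (WithLp.toLp 2 a) *
      (Matrix.of fun i j => e i j) := by
  set V : Matrix (Fin m) (Fin m) ℝ := Matrix.of fun i j => e i j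
  have hV : Vᵀ * V = 1 :=
    (mem_orthogonalGroup_iff' _ _).1 (of_orthonormalBasis_mem_orthogonalGroup e)
  have key : X * Vᵀ = (Matrix.of fun i j => u i j)ᵀ * rectDiag n (WithLp.toLp 2 a) := by
    ext i j
    have h1 := congrArg (fun y => y i) (h j)
    simp only [toEuclideanLin, toLpLin_apply] at h1
    simp only [mul_apply, transpose_apply, rectDiag, of_apply]
    rw [Finset.sum_eq_single (Fin.castLE hmn j)]
    · simpa [V, mulVec, dotProduct, mul_comm] using h1
    · intro k _ hk
      have : (k : ℕ) ≠ j := fun h' => hk (Fin.ext h')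
      simp [this]
    · simp
  rw [← key, Matrix.mul_assoc, hV, Matrix.mul_one]

open Matrix in
lemma inner_toEuclideanLin {n m : ℕ} (X Z : Matrix (Fin n) (Fin m) ℝ)
    (x z : EuclideanSpace ℝ (Fin m)) :
    inner ℝ (toEuclideanLin X x) (toEuclideanLin Z z) =
      inner ℝ x (toEuclideanLin (Xᵀ * Z) z) := by
  rw [← LinearMap.adjoint_inner_right, ← toEuclideanLin_conjTranspose_eq_adjoint]
  congr 1
  ext i : 1
  simp [toEuclideanLin, toLpLin_apply, Matrix.conjTranspose_eq_transpose_of_trivial]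

open Matrix in
/-- Two matrices `X`, `Z` with `XᵀZ` and `XZᵀ` symmetric have a simultaneous singular value
decomposition (up to order and signs). -/
theorem exists_simultaneous_svd {n m : ℕ} (hmn : m ≤ n) (X Z : Matrix (Fin n) (Fin m) ℝ)
    (h1 : Xᵀ * Z = Zᵀ * X) (h2 : X * Zᵀ = Z * Xᵀ) :
    ∃ U ∈ orthogonalGroup (Fin n) ℝ, ∃ V ∈ orthogonalGroup (Fin m) ℝ,
      ∃ a b : EuclideanSpace ℝ (Fin m),
        X = Uᵀ * rectDiag n a * V ∧ Z = Uᵀ * rectDiag n b * V := by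
  -- The inner products among the vectors `X eⱼ`, `Z eⱼ` are the bilinear forms of these three
  -- matrices, so a joint eigenbasis makes vectors with different indices orthogonal.
  let G : Fin 3 → Matrix (Fin m) (Fin m) ℝ := ![Xᵀ * X, Xᵀ * Z, Zᵀ * Z]
  have hsym : ∀ i, (G i).IsHermitian := by
    intro i
    fin_cases i
    · simp [G, IsHermitian, conjTranspose_eq_transpose_of_trivial]
    · simp [G, IsHermitian, conjTranspose_eq_transpose_of_trivial, h1]
    · simp [G, IsHermitian, conjTranspose_eq_transpose_of_trivial]
  have e01 : Commute (Xᵀ * X) (Xᵀ * Z) := by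
    change Xᵀ * X * (Xᵀ * Z) = Xᵀ * Z * (Xᵀ * X)
    calc Xᵀ * X * (Xᵀ * Z) = Xᵀ * (X * Zᵀ) * X := by rw [h1]; simp only [Matrix.mul_assoc]
      _ = _ := by rw [h2]; simp only [Matrix.mul_assoc]
  have e12 : Commute (Xᵀ * Z) (Zᵀ * Z) := by
    change Xᵀ * Z * (Zᵀ * Z) = Zᵀ * Z * (Xᵀ * Z)
    calc Xᵀ * Z * (Zᵀ * Z) = Zᵀ * (X * Zᵀ) * Z := by rw [h1]; simp only [Matrix.mul_assoc]
      _ = _ := by rw [h2]; simp only [Matrix.mul_assoc]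
  -- Used twice: transposing it gives the last commutation relation, and on eigenvectors it gives
  -- equality in Cauchy–Schwarz.
  have e02' : Xᵀ * X * (Zᵀ * Z) = (Xᵀ * Z) * (Xᵀ * Z) := by
    calc Xᵀ * X * (Zᵀ * Z) = Xᵀ * (X * Zᵀ) * Z := by simp only [Matrix.mul_assoc]
      _ = _ := by rw [h2]; simp only [Matrix.mul_assoc]
  have e02 : Commute (Xᵀ * X) (Zᵀ * Z) := by
    have h3 := congrArg transpose e02'
    simp only [transpose_mul, transpose_transpose, ← h1] at h3
    exact e02'.trans h3.symm
  have hcomm : ∀ i j, Commute (G i) (G j) := by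
    intro i j
    fin_cases i <;> fin_cases j <;>
      simp only [G, Fin.zero_eta, Fin.mk_one, Fin.reduceFinMk, cons_val_zero, cons_val_one, cons_val]
    exacts [Commute.refl _, e01, e02, e01.symm, Commute.refl _, e12, e02.symm, e12.symm,
      Commute.refl _]
  obtain ⟨e, he⟩ := exists_orthonormalBasis_joint_eigenvectors (m := m) (by simp)
    (fun i => toEuclideanLin (G i)) (fun i => isSymmetric_toEuclideanLin_iff.2 (hsym i))
    (fun i j => by
      have := congrArg (fun A => toEuclideanLin A) (hcomm i j).eq
      ext x : 1
      have := LinearMap.congr_fun this x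
      simpa [toEuclideanLin, toLpLin_apply] using this)
  have hoff : ∀ i j, i ≠ j → inner ℝ (e i) (e j) = (0 : ℝ) := fun i j h => e.orthonormal.2 h
  have horth : ∀ (l : Fin 3) i j, i ≠ j → inner ℝ (e i) (toEuclideanLin (G l) (e j)) = (0 : ℝ) := by
    intro l i j hij
    obtain ⟨c, hc⟩ := he l j
    rw [hc, inner_smul_right, hoff i j hij, mul_zero]
  have hn1 : ∀ j, inner ℝ (e j) (e j) = (1 : ℝ) := fun j => by
    rw [real_inner_self_eq_norm_sq, e.orthonormal.1 j, one_pow]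
  obtain ⟨u, a, b, hab⟩ := exists_orthonormalBasis_of_parallel hmn (by simp)
    (fun j => toEuclideanLin X (e j)) (fun j => toEuclideanLin Z (e j))
    (fun i j h => by rw [inner_toEuclideanLin]; exact horth 0 i j h)
    (fun i j h => by rw [inner_toEuclideanLin]; exact horth 1 i j h)
    (fun i j h => by rw [inner_toEuclideanLin]; exact horth 2 i j h)
    (fun j => by
      obtain ⟨c0, hc0⟩ := he 0 j
      obtain ⟨c1, hc1⟩ := he 1 j
      obtain ⟨c2, hc2⟩ := he 2 j
      have hxx : ‖toEuclideanLin X (e j)‖ ^ 2 = c0 := by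
        rw [← real_inner_self_eq_norm_sq, inner_toEuclideanLin]
        exact (congrArg _ hc0).trans (by rw [inner_smul_right, hn1, mul_one])
      have hzz : ‖toEuclideanLin Z (e j)‖ ^ 2 = c2 := by
        rw [← real_inner_self_eq_norm_sq, inner_toEuclideanLin]
        exact (congrArg _ hc2).trans (by rw [inner_smul_right, hn1, mul_one])
      have hxz : inner ℝ (toEuclideanLin X (e j)) (toEuclideanLin Z (e j)) = c1 := by
        rw [inner_toEuclideanLin]
        exact (congrArg _ hc1).trans (by rw [inner_smul_right, hn1, mul_one])
      -- Equality in Cauchy–Schwarz for `X eⱼ` and `Z eⱼ`, which makes them parallel.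
      have hprod : c0 * c2 = c1 ^ 2 := by
        have h4 := congrArg (fun A => inner ℝ (e j) (toEuclideanLin A (e j))) e02'
        have hm : ∀ A B : Matrix (Fin m) (Fin m) ℝ, ∀ x, toEuclideanLin (A * B) x =
            toEuclideanLin A (toEuclideanLin B x) := fun A B x => by
          simp [toEuclideanLin, toLpLin_apply]
        change toEuclideanLin (Xᵀ * X) (e j) = _ at hc0
        change toEuclideanLin (Xᵀ * Z) (e j) = _ at hc1
        change toEuclideanLin (Zᵀ * Z) (e j) = _ at hc2
        simp only [hm (Xᵀ * X), hm (Xᵀ * Z), hc0, hc1, hc2, map_smul, inner_smul_right, hn1] at h4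
        linarith
      rw [hxz]
      refine (sq_eq_sq₀ (abs_nonneg _) (by positivity)).1 ?_
      rw [sq_abs, mul_pow, hxx, hzz, hprod])
  exact ⟨_, of_orthonormalBasis_mem_orthogonalGroup u, _, of_orthonormalBasis_mem_orthogonalGroup e,
    WithLp.toLp 2 a, WithLp.toLp 2 b,
    eq_transpose_mul_rectDiag_mul hmn X u e a fun j => (hab j).1,
    eq_transpose_mul_rectDiag_mul hmn Z u e b fun j => (hab j).2⟩

/-! ### Rearrangement inequalities -/

/-- Abel summation: a nonincreasing nonnegative weight preserves domination of partial sums. -/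
lemma sum_mul_le_sum_mul_of_partial_sums {m : ℕ} {a c d : Fin m → ℝ} (ha : Antitone a)
    (ha0 : ∀ i, 0 ≤ a i)
    (h : ∀ k : ℕ, ∑ j : Fin m, (if (j : ℕ) < k then c j else 0) ≤
      ∑ j : Fin m, if (j : ℕ) < k then d j else 0) :
    ∑ j, a j * c j ≤ ∑ j, a j * d j := by
  -- The statement is strengthened by a lower bound `r` for the weights so that induction works: the
  -- hypothesis is applied with `r` equal to the last weight. The lemma itself is the case `r = 0`.
  have key : ∀ (m : ℕ) (a e : Fin m → ℝ), Antitone a → (∀ i, 0 ≤ a i) →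
      (∀ k : ℕ, 0 ≤ ∑ j : Fin m, if (j : ℕ) < k then e j else 0) →
      ∀ r, 0 ≤ r → (∀ i, r ≤ a i) → r * ∑ j, e j ≤ ∑ j, a j * e j := by
    intro m
    induction m with
    | zero => intros; simp
    | succ m ih =>
      intro a e ha ha0 he r hr hra
      have hle : ∀ k, k ≤ m → 0 ≤ ∑ j : Fin m, if (j : ℕ) < k then e j.castSucc else 0 := by
        intro k hk
        have := he k
        rw [Fin.sum_univ_castSucc] at this
        simpa [hk.not_gt] using this
      have h1 := ih (fun i => a i.castSucc) (fun i => e i.castSucc)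
        (fun i j hij => ha (Fin.castSucc_le_castSucc_iff.2 hij)) (fun i => ha0 _)
        -- Capping `k` at `m` leaves the shorter sum unchanged and keeps the last entry out of the
        -- partial sum supplied by `he`.
        (fun k => by
          refine (hle (min k m) (min_le_right _ _)).trans_eq (Finset.sum_congr rfl fun j _ => ?_)
          simp [j.2]) (a (Fin.last m)) (ha0 _) (fun i => ha (Fin.le_last _))
      have h2 : 0 ≤ ∑ j, e j := by
        refine (he (m + 1)).trans_eq (Finset.sum_congr rfl fun j _ => ?_)
        simp [j.2]
      calc r * ∑ j, e j ≤ a (Fin.last m) * ∑ j, e j :=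
            mul_le_mul_of_nonneg_right (hra _) h2
        _ = a (Fin.last m) * ∑ j : Fin m, e j.castSucc + a (Fin.last m) * e (Fin.last m) := by
            rw [Fin.sum_univ_castSucc, mul_add]
        _ ≤ _ := by rw [Fin.sum_univ_castSucc]; linarith
  have := key m a (fun j => d j - c j) ha ha0 (fun k => by
    have h1 := sub_nonneg.2 (h k)
    rw [← Finset.sum_sub_distrib] at h1
    refine h1.trans_eq (Finset.sum_congr rfl fun j _ => ?_)
    split_ifs <;> simp) 0 le_rfl ha0
  simpa [mul_sub, Finset.sum_sub_distrib] using this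

/-- Abel summation in each index separately reduces the claim to the leading `p × q` blocks of `D`,
whose entries sum to at most `min p q`. -/
lemma sum_mul_mul_le_of_doubly_substochastic {m : ℕ} {a b : Fin m → ℝ} (ha : Antitone a)
    (ha0 : ∀ i, 0 ≤ a i) (hb : Antitone b) (hb0 : ∀ i, 0 ≤ b i) {D : Fin m → Fin m → ℝ}
    (hD : ∀ i k, 0 ≤ D i k) (hrow : ∀ i, ∑ k, D i k ≤ 1) (hcol : ∀ k, ∑ i, D i k ≤ 1) :
    ∑ i, ∑ k, a i * b k * D i k ≤ ∑ i, a i * b i := by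
  have h1 : ∀ p : ℕ, ∑ k, b k * (∑ i : Fin m, if (i : ℕ) < p then D i k else 0) ≤
      ∑ k, b k * (if (k : ℕ) < p then 1 else 0) := by
    intro p
    refine sum_mul_le_sum_mul_of_partial_sums hb hb0 fun q => ?_
    -- With fewer columns than rows the block is bounded by its column sums; otherwise the sums are
    -- interchanged and row sums are used.
    rcases le_total q p with hqp | hpq
    · refine Finset.sum_le_sum fun k _ => ?_
      split_ifs with h h'
      · refine (Finset.sum_le_sum fun i _ => ?_).trans (hcol k)
        split_ifs
        exacts [le_rfl, hD i k]
      · omega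
      · exact le_rfl
    · calc _ = ∑ i : Fin m, if (i : ℕ) < p then (∑ k : Fin m, if (k : ℕ) < q then D i k else 0)
            else 0 := by
            rw [← Finset.sum_filter]
            simp_rw [← Finset.sum_filter]
            rw [Finset.sum_comm]
        _ ≤ _ := by
            refine Finset.sum_le_sum fun k _ => ?_
            split_ifs with h h'
            · refine (Finset.sum_le_sum fun i _ => ?_).trans (hrow k)
              split_ifs
              exacts [le_rfl, hD k i]
            · omega
            · exact le_rfl
            · exact le_rfl
  have h2 : ∑ i, a i * (∑ k, b k * D i k) ≤ ∑ i, a i * b i := by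
    refine sum_mul_le_sum_mul_of_partial_sums ha ha0 fun p => ?_
    refine le_trans (le_of_eq ?_) ((h1 p).trans (le_of_eq ?_))
    · simp_rw [← Finset.sum_filter, Finset.mul_sum]
      rw [Finset.sum_comm]
    · simp
  simpa [Finset.mul_sum, mul_assoc] using h2

/-! ### The trace inner product and the isometries `x ↦ Uᵀ (Diag x) V` -/

open Matrix in
lemma matrix_inner_def {n m : ℕ} (X Y : Matrix (Fin n) (Fin m) ℝ) :
    inner ℝ X Y = (Xᵀ * Y).trace := rfl

open Matrix in
lemma matrix_inner_orthogonal {n m : ℕ} {U : Matrix (Fin n) (Fin n) ℝ}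
    (hU : U ∈ orthogonalGroup (Fin n) ℝ) {V : Matrix (Fin m) (Fin m) ℝ}
    (hV : V ∈ orthogonalGroup (Fin m) ℝ) (A B : Matrix (Fin n) (Fin m) ℝ) :
    inner ℝ (Uᵀ * A * V) (Uᵀ * B * V) = inner ℝ A B := by
  have hU' : U * Uᵀ = 1 := (mem_orthogonalGroup_iff _ _).1 hU
  have hV' : V * Vᵀ = 1 := (mem_orthogonalGroup_iff _ _).1 hV
  rw [matrix_inner_def, matrix_inner_def]
  have : (Uᵀ * A * V)ᵀ * (Uᵀ * B * V) = Vᵀ * (Aᵀ * B * V) := by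
    simp only [transpose_mul, Matrix.mul_assoc, transpose_transpose]
    rw [← Matrix.mul_assoc U, hU', Matrix.one_mul]
  rw [this, trace_mul_comm, Matrix.mul_assoc, hV', Matrix.mul_one]

lemma inner_rectDiag {n m : ℕ} (hmn : m ≤ n) (x y : EuclideanSpace ℝ (Fin m)) :
    inner ℝ (rectDiag n x) (rectDiag n y) = (inner ℝ x y : ℝ) := by
  rw [matrix_inner_def, transpose_rectDiag_mul_rectDiag hmn, Matrix.trace_diagonal,
    PiLp.inner_apply]
  simp [mul_comm]

open Matrix in
/-- The isometric embedding `x ↦ Uᵀ (Diag x) V` given by orthogonal matrices `U` and `V`. -/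
noncomputable def svdEmbedding {n m : ℕ} (hmn : m ≤ n) (U : orthogonalGroup (Fin n) ℝ)
    (V : orthogonalGroup (Fin m) ℝ) :
    EuclideanSpace ℝ (Fin m) →ₗᵢ[ℝ] Matrix (Fin n) (Fin m) ℝ where
  toFun x := (U : Matrix (Fin n) (Fin n) ℝ)ᵀ * rectDiag n x * (V : Matrix (Fin m) (Fin m) ℝ)
  map_add' x y := by
    rw [← Matrix.add_mul, ← Matrix.mul_add]
    congr 2
    ext i j
    simp only [rectDiag, of_apply, Matrix.add_apply]
    split_ifs <;> simp
  map_smul' r x := by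
    rw [RingHom.id_apply, ← Matrix.smul_mul, ← Matrix.mul_smul]
    congr 2
    ext i j
    simp only [rectDiag, of_apply, Matrix.smul_apply]
    split_ifs <;> simp
  norm_map' x := by
    refine (sq_eq_sq₀ (norm_nonneg _) (norm_nonneg _)).1 ?_
    rw [← real_inner_self_eq_norm_sq, ← real_inner_self_eq_norm_sq]
    exact (matrix_inner_orthogonal U.2 V.2 _ _).trans (inner_rectDiag hmn x x)

open Matrix in
lemma svdEmbedding_apply {n m : ℕ} (hmn : m ≤ n) (U : orthogonalGroup (Fin n) ℝ)
    (V : orthogonalGroup (Fin m) ℝ) (x : EuclideanSpace ℝ (Fin m)) :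
    svdEmbedding hmn U V x =
      (U : Matrix (Fin n) (Fin n) ℝ)ᵀ * rectDiag n x * (V : Matrix (Fin m) (Fin m) ℝ) := rfl

open Matrix in
lemma transpose_mem_orthogonalGroup {n : ℕ} (U : orthogonalGroup (Fin n) ℝ) :
    (U : Matrix (Fin n) (Fin n) ℝ)ᵀ ∈ orthogonalGroup (Fin n) ℝ :=
  (star U).2

open Matrix in
lemma singularValueMap_svdEmbedding {n m : ℕ} (hmn : m ≤ n) (U : orthogonalGroup (Fin n) ℝ)
    (V : orthogonalGroup (Fin m) ℝ) (x : EuclideanSpace ℝ (Fin m)) :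
    singularValueMap (svdEmbedding hmn U V x) = singularValueMap (rectDiag n x) :=
  singularValueMap_orthogonal_mul_mul (transpose_mem_orthogonalGroup U) V.2 _

lemma exists_svdEmbedding_eq {n m : ℕ} (hmn : m ≤ n) (X : Matrix (Fin n) (Fin m) ℝ) :
    ∃ U V a, X = svdEmbedding hmn U V a := by
  obtain ⟨U, hU, V, hV, a, -, h, -⟩ := exists_simultaneous_svd hmn X 0 (by simp) (by simp)
  exact ⟨⟨U, hU⟩, ⟨V, hV⟩, a, h⟩

lemma exists_singularValueMap_svdEmbedding {n m : ℕ} (hmn : m ≤ n)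
    (U : Matrix.orthogonalGroup (Fin n) ℝ) (V : Matrix.orthogonalGroup (Fin m) ℝ)
    (x : EuclideanSpace ℝ (Fin m)) :
    ∃ π s, singularValueMap (svdEmbedding hmn U V x) = signedPerm π s x := by
  rw [singularValueMap_svdEmbedding]
  exact exists_singularValueMap_rectDiag hmn x

lemma norm_singularValueMap {n m : ℕ} (hmn : m ≤ n) (X : Matrix (Fin n) (Fin m) ℝ) :
    ‖singularValueMap X‖ = ‖X‖ := by
  obtain ⟨U, V, a, rfl⟩ := exists_svdEmbedding_eq hmn X
  obtain ⟨π, s, h⟩ := exists_singularValueMap_svdEmbedding hmn U V a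
  rw [h, LinearIsometry.norm_map, ← signedPermIsometry_apply, LinearIsometryEquiv.norm_map]

/-! ### Von Neumann's trace inequality and the Lipschitz property of `σ` -/

open Matrix in
lemma sum_sq_row_of_mem_orthogonalGroup {n : ℕ} {R : Matrix (Fin n) (Fin n) ℝ}
    (hR : R ∈ orthogonalGroup (Fin n) ℝ) (i : Fin n) : ∑ j, R i j ^ 2 = 1 := by
  have := congrArg (fun A => A i i) ((mem_orthogonalGroup_iff _ _).1 hR)
  simpa [mul_apply, ← sq] using this

open Matrix in
lemma sum_sq_col_of_mem_orthogonalGroup {n : ℕ} {R : Matrix (Fin n) (Fin n) ℝ}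
    (hR : R ∈ orthogonalGroup (Fin n) ℝ) (j : Fin n) : ∑ i, R i j ^ 2 = 1 := by
  have := congrArg (fun A => A j j) ((mem_orthogonalGroup_iff' _ _).1 hR)
  simpa [mul_apply, ← sq] using this

lemma sum_castLE_le_sum {n m : ℕ} (hmn : m ≤ n) {g : Fin n → ℝ} (hg : ∀ i, 0 ≤ g i) :
    ∑ i : Fin m, g (Fin.castLE hmn i) ≤ ∑ i, g i := by
  rw [← Finset.sum_image (f := g) (s := Finset.univ) (g := Fin.castLE hmn)
    (fun i _ j _ h => Fin.castLE_injective hmn h)]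
  exact Finset.sum_le_sum_of_subset_of_nonneg (Finset.subset_univ _) fun i _ _ => hg i

open Matrix in
lemma rectDiag_transpose_mul_apply {n m : ℕ} (hmn : m ≤ n) (a : EuclideanSpace ℝ (Fin m))
    (B : Matrix (Fin n) (Fin m) ℝ) (i j : Fin m) :
    ((rectDiag n a)ᵀ * B) i j = a i * B (Fin.castLE hmn i) j := by
  simp only [rectDiag, mul_apply, transpose_apply, of_apply]
  rw [Finset.sum_eq_single (Fin.castLE hmn i)]
  · simp
  · intro k _ hk
    have : (k : ℕ) ≠ i := fun h' => hk (Fin.ext h')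
    simp [this]
  · simp

open Matrix in
lemma mul_rectDiag_apply {n m : ℕ} (hmn : m ≤ n) (a : EuclideanSpace ℝ (Fin m))
    (B : Matrix (Fin n) (Fin n) ℝ) (i : Fin n) (j : Fin m) :
    (B * rectDiag n a) i j = B i (Fin.castLE hmn j) * a j := by
  simp only [rectDiag, mul_apply, of_apply]
  rw [Finset.sum_eq_single (Fin.castLE hmn j)]
  · simp
  · intro k _ hk
    have : (k : ℕ) ≠ j := fun h' => hk (Fin.ext h')
    simp [this]
  · simp

open Matrix in
/-- **Von Neumann's trace inequality.** -/
theorem inner_le_inner_singularValueMap {n m : ℕ} (hmn : m ≤ n) (X Y : Matrix (Fin n) (Fin m) ℝ) :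
    inner ℝ X Y ≤ (inner ℝ (singularValueMap X) (singularValueMap Y) : ℝ) := by
  obtain ⟨U, V, a, hX⟩ := exists_svdEmbedding_eq hmn X
  obtain ⟨P, Q, b, hY⟩ := exists_svdEmbedding_eq hmn Y
  obtain ⟨π, s, ha⟩ := exists_singularValueMap_svdEmbedding hmn U V a
  obtain ⟨ρ, t, hb⟩ := exists_singularValueMap_svdEmbedding hmn P Q b
  rw [← hX] at ha
  rw [← hY] at hb
  have ha' : ∀ i, |a (π i)| = singularValueMap X i := fun i => by
    rw [← sq_eq_sq₀ (abs_nonneg _) (singularValueMap_nonneg X i), sq_abs, ha, signedPerm_sq]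
  have hb' : ∀ i, |b (ρ i)| = singularValueMap Y i := fun i => by
    rw [← sq_eq_sq₀ (abs_nonneg _) (singularValueMap_nonneg Y i), sq_abs, hb, signedPerm_sq]
  let R : orthogonalGroup (Fin n) ℝ := U * star P
  let S : orthogonalGroup (Fin m) ℝ := Q * star V
  have hRv : (R : Matrix (Fin n) (Fin n) ℝ) = (U : Matrix (Fin n) (Fin n) ℝ) *
    (P : Matrix (Fin n) (Fin n) ℝ)ᵀ := rfl
  have hSv : (S : Matrix (Fin m) (Fin m) ℝ) = (Q : Matrix (Fin m) (Fin m) ℝ) *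
    (V : Matrix (Fin m) (Fin m) ℝ)ᵀ := rfl
  -- Bounding `|r s|` by `(r² + s²) / 2` replaces products of entries of `R` and `S` by a
  -- nonnegative matrix. It is only substochastic, because `R` is cut down from size `n` to `m`.
  let D : Fin m → Fin m → ℝ := fun i k =>
    ((R : Matrix (Fin n) (Fin n) ℝ) (Fin.castLE hmn i) (Fin.castLE hmn k) ^ 2 +
      (S : Matrix (Fin m) (Fin m) ℝ) k i ^ 2) / 2
  have h1 : inner ℝ X Y = ∑ i, ∑ k, a i * b k *
      ((R : Matrix (Fin n) (Fin n) ℝ) (Fin.castLE hmn i) (Fin.castLE hmn k) *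
        (S : Matrix (Fin m) (Fin m) ℝ) k i) := by
    rw [matrix_inner_def, hX, hY, svdEmbedding_apply, svdEmbedding_apply]
    rw [transpose_mul, Matrix.mul_assoc, trace_mul_comm]
    have : ((U : Matrix (Fin n) (Fin n) ℝ)ᵀ * rectDiag n a)ᵀ *
        ((P : Matrix (Fin n) (Fin n) ℝ)ᵀ * rectDiag n b * (Q : Matrix (Fin m) (Fin m) ℝ)) *
        (V : Matrix (Fin m) (Fin m) ℝ)ᵀ = (rectDiag n a)ᵀ * ((R : Matrix (Fin n) (Fin n) ℝ) * rectDiag n b *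
          (S : Matrix (Fin m) (Fin m) ℝ)) := by
      rw [hRv, hSv]
      simp only [transpose_mul, transpose_transpose, Matrix.mul_assoc]
    rw [this]
    simp only [trace, diag_apply, rectDiag_transpose_mul_apply hmn]
    refine Finset.sum_congr rfl fun i _ => ?_
    rw [mul_apply, Finset.mul_sum]
    refine Finset.sum_congr rfl fun k _ => ?_
    rw [mul_rectDiag_apply hmn]
    ring
  have h2 : inner ℝ X Y ≤ ∑ i, ∑ k, |a i| * |b k| * D i k := by
    rw [h1]
    refine Finset.sum_le_sum fun i _ => Finset.sum_le_sum fun k _ => ?_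
    refine (le_abs_self _).trans ?_
    rw [abs_mul, abs_mul]
    refine mul_le_mul_of_nonneg_left ?_ (by positivity)
    rw [abs_le]
    constructor <;> simp only [D]
    · nlinarith [sq_nonneg ((R : Matrix (Fin n) (Fin n) ℝ) (Fin.castLE hmn i) (Fin.castLE hmn k) +
        (S : Matrix (Fin m) (Fin m) ℝ) k i)]
    · nlinarith [sq_nonneg ((R : Matrix (Fin n) (Fin n) ℝ) (Fin.castLE hmn i) (Fin.castLE hmn k) -
        (S : Matrix (Fin m) (Fin m) ℝ) k i)]
  have hrow : ∀ i, ∑ k, D i k ≤ 1 := by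
    intro i
    have e1 := sum_castLE_le_sum hmn (g := fun k => (R : Matrix (Fin n) (Fin n) ℝ)
      (Fin.castLE hmn i) k ^ 2) fun _ => sq_nonneg _
    rw [sum_sq_row_of_mem_orthogonalGroup R.2] at e1
    have e2 := sum_sq_col_of_mem_orthogonalGroup S.2 i
    simp only [D]
    rw [← Finset.sum_div, Finset.sum_add_distrib]
    linarith
  have hcol : ∀ k, ∑ i, D i k ≤ 1 := by
    intro k
    have e1 := sum_castLE_le_sum hmn (g := fun i => (R : Matrix (Fin n) (Fin n) ℝ)
      i (Fin.castLE hmn k) ^ 2) fun _ => sq_nonneg _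
    rw [sum_sq_col_of_mem_orthogonalGroup R.2] at e1
    have e2 := sum_sq_row_of_mem_orthogonalGroup S.2 k
    simp only [D]
    rw [← Finset.sum_div, Finset.sum_add_distrib]
    linarith
  -- Reindexing by the sorting permutations makes both weights nonincreasing; row and column sums of
  -- `D` are insensitive to it.
  have h3 : ∑ i, ∑ k, |a i| * |b k| * D i k =
      ∑ i, ∑ k, singularValueMap X i * singularValueMap Y k * D (π i) (ρ k) := by
    rw [← Equiv.sum_comp π]
    refine Finset.sum_congr rfl fun i _ => ?_
    rw [← Equiv.sum_comp ρ]
    simp only [ha', hb']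
  refine h2.trans (h3.trans_le ((sum_mul_mul_le_of_doubly_substochastic
    (singularValueMap_antitone X) (singularValueMap_nonneg X) (singularValueMap_antitone Y)
    (singularValueMap_nonneg Y) (D := fun i k => D (π i) (ρ k)) (fun i k => ?_) (fun i => ?_)
    (fun k => ?_)).trans (le_of_eq ?_)))
  · simp only [D]; positivity
  · rw [Equiv.sum_comp ρ fun k => D (π i) k]; exact hrow _
  · rw [Equiv.sum_comp π fun i => D i (ρ k)]; exact hcol _
  · rw [PiLp.inner_apply]; simp [mul_comm]

/-- Expansion of squared distances used to compare `σ` with the inner product. -/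
lemma inner_singularValueMap_sub_inner {n m : ℕ} (hmn : m ≤ n) (X Y : Matrix (Fin n) (Fin m) ℝ) :
    inner ℝ (singularValueMap X) (singularValueMap Y) - inner ℝ X Y =
      (‖Y - X‖ ^ 2 - ‖singularValueMap Y - singularValueMap X‖ ^ 2) / 2 := by
  rw [norm_sub_sq_real, norm_sub_sq_real, norm_singularValueMap hmn, norm_singularValueMap hmn,
    real_inner_comm X Y, real_inner_comm (singularValueMap X)]
  ring

/-- By the preceding expansion, this is the trace inequality in terms of distances. -/
lemma norm_singularValueMap_sub_le {n m : ℕ} (hmn : m ≤ n) (X Y : Matrix (Fin n) (Fin m) ℝ) :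
    ‖singularValueMap Y - singularValueMap X‖ ≤ ‖Y - X‖ := by
  have h1 := inner_singularValueMap_sub_inner hmn X Y
  have h2 := inner_le_inner_singularValueMap hmn X Y
  exact (sq_le_sq₀ (norm_nonneg _) (norm_nonneg _)).1 (by linarith)

lemma continuous_singularValueMap {n m : ℕ} (hmn : m ≤ n) :
    Continuous (singularValueMap : Matrix (Fin n) (Fin m) ℝ → EuclideanSpace ℝ (Fin m)) := by
  refine (LipschitzWith.of_dist_le_mul (K := 1) fun X Y => ?_).continuous
  rw [dist_eq_norm, dist_eq_norm, NNReal.coe_one, one_mul]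
  exact norm_singularValueMap_sub_le hmn Y X

/-! ### Subdifferentials under local changes, isometries and curves -/

section Variational

variable {E F : Type*} [NormedAddCommGroup E] [InnerProductSpace ℝ E]
  [NormedAddCommGroup F] [InnerProductSpace ℝ F]

lemma frechetSubdiff_congr {f g : E → EReal} {x : E} (h : f =ᶠ[𝓝 x] g) :
    frechetSubdiff f x = frechetSubdiff g x := by
  ext v
  simp only [frechetSubdiff, Set.mem_ofPred_eq, h.eq_of_nhds]
  refine and_congr_right fun _ => and_congr_right fun _ => forall_congr' fun ε =>
    imp_congr_right fun _ => ?_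
  exact eventually_congr (h.mono fun y hy => by rw [hy])

lemma limitingSubdiff_subset_of_eventuallyEq {f g : E → EReal} {x : E} (h : f =ᶠ[𝓝 x] g) :
    limitingSubdiff f x ⊆ limitingSubdiff g x := by
  rintro v ⟨h1, h2, xs, vs, hv, hx, hfx, hvs⟩
  rw [h.eq_of_nhds] at h1 h2 hfx
  -- On this tail `f` and `g` agree on a neighbourhood of each `xs i`, not merely at it, so their
  -- Fréchet subdifferentials coincide.
  obtain ⟨N, hN⟩ := eventually_atTop.1 (hx.eventually h.eventually_nhds)
  refine ⟨h1, h2, fun i => xs (i + N), fun i => vs (i + N), fun i => ?_,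
    hx.comp (tendsto_add_atTop_nat N), ?_, hvs.comp (tendsto_add_atTop_nat N)⟩
  · rw [← frechetSubdiff_congr (hN (i + N) (Nat.le_add_left _ _))]
    exact hv _
  · refine (hfx.comp (tendsto_add_atTop_nat N)).congr fun i => ?_
    exact Filter.EventuallyEq.eq_of_nhds (hN (i + N) (Nat.le_add_left _ _))

lemma limitingSubdiff_congr {f g : E → EReal} {x : E} (h : f =ᶠ[𝓝 x] g) :
    limitingSubdiff f x = limitingSubdiff g x :=
  (limitingSubdiff_subset_of_eventuallyEq h).antisymm
    (limitingSubdiff_subset_of_eventuallyEq h.symm)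

/-- Identifiability is a local property. -/
lemma IsIdentifiableAt.congr {f g : E → EReal} {M N : Set E} {x v : E} (h : f =ᶠ[𝓝 x] g)
    (hM : ∀ᶠ y in 𝓝 x, y ∈ M ↔ y ∈ N) (hN : N ⊆ effDomain g) (H : IsIdentifiableAt f M x v) :
    IsIdentifiableAt g N x v where
  subset_domain := hN
  mem_subdiff := limitingSubdiff_congr h ▸ H.mem_subdiff
  eventually_mem := by
    intro xs vs hv hx hgx hvs
    obtain ⟨K, hK⟩ := eventually_atTop.1 (hx.eventually h.eventually_nhds)
    rw [← h.eq_of_nhds] at hgx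
    have h1 := H.eventually_mem (fun i => xs (i + K)) (fun i => vs (i + K))
      (fun i => by
        rw [limitingSubdiff_congr (hK (i + K) (Nat.le_add_left _ _))]
        exact hv _)
      (hx.comp (tendsto_add_atTop_nat K))
      ((hgx.comp (tendsto_add_atTop_nat K)).congr fun i =>
        (Filter.EventuallyEq.eq_of_nhds (hK (i + K) (Nat.le_add_left _ _))).symm)
      (hvs.comp (tendsto_add_atTop_nat K))
    have h2 : ∀ᶠ i in atTop, xs i ∈ M := by
      obtain ⟨K', hK'⟩ := eventually_atTop.1 h1
      refine eventually_atTop.2 ⟨K' + K, fun i hi => ?_⟩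
      simpa [Nat.sub_add_cancel (show K ≤ i by omega)] using hK' (i - K) (by omega)
    filter_upwards [h2, hx.eventually hM] with i hi hi' using hi'.1 hi

/-- Fréchet subgradients restrict along isometric embeddings. -/
lemma mem_frechetSubdiff_of_isometry (L : E →ₗᵢ[ℝ] F) {g : F → EReal} {f : E → EReal}
    (hf : ∀ y, g (L y) = f y) {x v : E} (h : L v ∈ frechetSubdiff g (L x)) :
    v ∈ frechetSubdiff f x := by
  obtain ⟨h1, h2, h3⟩ := h
  rw [hf] at h1 h2
  refine ⟨h1, h2, fun ε hε => ?_⟩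
  filter_upwards [L.continuous.continuousAt.eventually (h3 ε hε)] with y hy
  rwa [hf, hf, ← map_sub, L.inner_map_map, L.norm_map] at hy

lemma mem_frechetSubdiff_isometryEquiv_iff (L : E ≃ₗᵢ[ℝ] E) {f : E → EReal}
    (hf : ∀ y, f (L y) = f y) {x v : E} :
    L v ∈ frechetSubdiff f (L x) ↔ v ∈ frechetSubdiff f x := by
  refine ⟨mem_frechetSubdiff_of_isometry L.toLinearIsometry hf, fun h => ?_⟩
  refine mem_frechetSubdiff_of_isometry L.symm.toLinearIsometry (g := f) (fun y => ?_) ?_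
  · simpa using (hf (L.symm y)).symm
  · simpa using h

lemma mem_limitingSubdiff_isometryEquiv (L : E ≃ₗᵢ[ℝ] E) {f : E → EReal}
    (hf : ∀ y, f (L y) = f y) {x v : E} (h : v ∈ limitingSubdiff f x) :
    L v ∈ limitingSubdiff f (L x) := by
  obtain ⟨h1, h2, xs, vs, hv, hx, hfx, hvs⟩ := h
  refine ⟨by rwa [hf], by rwa [hf], fun i => L (xs i), fun i => L (vs i),
    fun i => (mem_frechetSubdiff_isometryEquiv_iff L hf).2 (hv i),
    (L.continuous.tendsto _).comp hx, ?_, (L.continuous.tendsto _).comp hvs⟩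
  simpa only [hf] using hfx

lemma le_zero_of_coe_add_le {a : EReal} (h1 : a ≠ ⊥) (h2 : a ≠ ⊤) {c : ℝ}
    (h : a + (c : EReal) ≤ a) : c ≤ 0 := by
  lift a to ℝ using ⟨h2, h1⟩
  rw [← EReal.coe_add, EReal.coe_le_coe_iff] at h
  linarith

/-- A Fréchet subgradient is nonpositive on the velocity of a curve on which the function is
constant. -/
lemma inner_le_zero_of_mem_frechetSubdiff {f : E → EReal} {γ : ℝ → E} {v w : E}
    (hv : v ∈ frechetSubdiff f (γ 0)) (hγ : HasDerivAt γ w 0) (hf : ∀ t, f (γ t) = f (γ 0)) :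
    inner ℝ v w ≤ (0 : ℝ) := by
  obtain ⟨h1, h2, h3⟩ := hv
  have hslope := hasDerivAt_iff_tendsto_slope_zero.1 hγ
  -- Only the right-hand slope is used, so that multiplying by `t⁻¹` preserves the inequality.
  have hs : Tendsto (fun t : ℝ => t⁻¹ • (γ (0 + t) - γ 0)) (𝓝[>] 0) (𝓝 w) :=
    hslope.mono_left (nhdsWithin_mono _ fun t ht => ne_of_gt ht)
  have key : ∀ ε : ℝ, 0 < ε → inner ℝ v w - ε * ‖w‖ ≤ 0 := by
    intro ε hε
    have hlim : Tendsto (fun t : ℝ => inner ℝ v (t⁻¹ • (γ (0 + t) - γ 0)) -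
        ε * ‖t⁻¹ • (γ (0 + t) - γ 0)‖) (𝓝[>] 0) (𝓝 (inner ℝ v w - ε * ‖w‖)) :=
      (tendsto_const_nhds.inner hs).sub (hs.norm.const_mul ε)
    refine le_of_tendsto hlim ?_
    filter_upwards [(hγ.continuousAt.tendsto.mono_left nhdsWithin_le_nhds).eventually (h3 ε hε),
      self_mem_nhdsWithin] with t ht htpos
    have htpos : 0 < t := htpos
    rw [hf t] at ht
    have h4 := le_zero_of_coe_add_le h1 h2 ht
    rw [inner_smul_right, norm_smul, norm_inv, Real.norm_of_nonneg htpos.le, zero_add]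
    have : t⁻¹ * inner ℝ v (γ t - γ 0) - ε * (t⁻¹ * ‖γ t - γ 0‖) =
        t⁻¹ * (inner ℝ v (γ t - γ 0) - ε * ‖γ t - γ 0‖) := by ring
    rw [this]
    exact mul_nonpos_of_nonneg_of_nonpos (inv_nonneg.2 htpos.le) h4
  have hlim : Tendsto (fun ε : ℝ => inner ℝ v w - ε * ‖w‖) (𝓝[>] 0)
      (𝓝 (inner ℝ v w - 0 * ‖w‖)) :=
    ((tendsto_const_nhds.sub (tendsto_id.mul_const _)).mono_left nhdsWithin_le_nhds)
  simpa using le_of_tendsto hlim (eventually_mem_nhdsWithin.mono fun ε hε => key ε hε)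

end Variational

/-! ### Orthogonal orbits and simultaneous diagonalization of subgradients -/

section Exponential

open Matrix NormedSpace

attribute [local instance] Matrix.frobeniusNormedRing Matrix.frobeniusNormedAlgebra

/-- For skew `A` the transpose of `exp (t A)` is `exp (-t A)`. These curves supply the tangent
directions along which `f ∘ σ` is constant. -/
lemma exp_smul_mem_orthogonalGroup {k : ℕ} {A : Matrix (Fin k) (Fin k) ℝ} (hA : Aᵀ = -A) (t : ℝ) :
    exp (t • A) ∈ orthogonalGroup (Fin k) ℝ := by
  rw [mem_orthogonalGroup_iff, ← Matrix.exp_transpose, transpose_smul, hA, smul_neg,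
    ← Matrix.exp_add_of_commute _ _ (show Commute (t • A) (-(t • A)) from
      (Commute.refl (t • A)).neg_right), add_neg_cancel, exp_zero]

lemma hasDerivAt_exp_smul_mul {n m : ℕ} (A : Matrix (Fin n) (Fin n) ℝ)
    (X : Matrix (Fin n) (Fin m) ℝ) :
    HasDerivAt (fun t : ℝ => exp (t • A) * X) (A * X) 0 := by
  have h := hasDerivAt_exp_smul_const (𝕂 := ℝ) A 0
  rw [zero_smul, exp_zero, one_mul] at h
  let R : Matrix (Fin n) (Fin n) ℝ →ₗ[ℝ] Matrix (Fin n) (Fin m) ℝ := mulRightLinearMap (Fin n) ℝ X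
  exact (LinearMap.toContinuousLinearMap R).hasFDerivAt.comp_hasDerivAt (0 : ℝ) h

lemma hasDerivAt_mul_exp_smul {n m : ℕ} (B : Matrix (Fin m) (Fin m) ℝ)
    (X : Matrix (Fin n) (Fin m) ℝ) :
    HasDerivAt (fun t : ℝ => X * exp (t • B)) (X * B) 0 := by
  have h := hasDerivAt_exp_smul_const (𝕂 := ℝ) B 0
  rw [zero_smul, exp_zero, one_mul] at h
  let R : Matrix (Fin m) (Fin m) ℝ →ₗ[ℝ] Matrix (Fin n) (Fin m) ℝ := mulLeftLinearMap (Fin m) ℝ X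
  exact (LinearMap.toContinuousLinearMap R).hasFDerivAt.comp_hasDerivAt (0 : ℝ) h

end Exponential

-- For the skew matrix `A = Sᵀ - S` one has `tr (Aᵀ A) = 2 tr (A S)`, so the hypothesis forces `‖A‖²
-- ≤ 0`. Thus one well-chosen skew test direction suffices for symmetry.
open Matrix in
lemma transpose_eq_of_trace_le_zero {k : ℕ} {S : Matrix (Fin k) (Fin k) ℝ}
    (h : ((Sᵀ - S) * S).trace ≤ 0) : Sᵀ = S := by
  set A := Sᵀ - S with hA
  have hAt : Aᵀ = -A := by simp [hA]
  have h1 : (Aᵀ * A).trace = 2 * (A * S).trace := by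
    have h2 : (A * Sᵀ).trace = -(A * S).trace := by
      rw [← trace_transpose (A * Sᵀ), transpose_mul, hAt, transpose_transpose, Matrix.mul_neg,
        trace_neg, trace_mul_comm]
    have h3 : Aᵀ * A = A * S - A * Sᵀ := by
      rw [hAt, Matrix.neg_mul]
      nth_rw 2 [hA]
      rw [Matrix.mul_sub, neg_sub]
    rw [h3, trace_sub, h2]
    ring
  have h4 : ‖A‖ ^ 2 ≤ 0 := by
    rw [← real_inner_self_eq_norm_sq, matrix_inner_def, h1]
    linarith
  have h5 : A = 0 := norm_eq_zero.1 (pow_eq_zero_iff two_ne_zero |>.1 (le_antisymm h4 (sq_nonneg _)))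
  exact sub_eq_zero.1 h5

open Matrix in
/-- Fréchet subgradients of orthogonally invariant functions have a simultaneous singular value
decomposition with the base point. -/
theorem exists_svdEmbedding_of_mem_frechetSubdiff {n m : ℕ} (hmn : m ≤ n)
    {f : EuclideanSpace ℝ (Fin m) → EReal} {X Z : Matrix (Fin n) (Fin m) ℝ}
    (h : Z ∈ frechetSubdiff (f ∘ singularValueMap) X) :
    ∃ U V a b, X = svdEmbedding hmn U V a ∧ Z = svdEmbedding hmn U V b := by
  have hL : ∀ A : Matrix (Fin n) (Fin n) ℝ, Aᵀ = -A → inner ℝ Z (A * X) ≤ (0 : ℝ) := by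
    intro A hA
    have h0 : NormedSpace.exp ((0 : ℝ) • A) * X = X := by
      rw [zero_smul, NormedSpace.exp_zero, Matrix.one_mul]
    refine inner_le_zero_of_mem_frechetSubdiff (f := f ∘ singularValueMap) ?_
      (hasDerivAt_exp_smul_mul A X) fun t => ?_
    · rwa [h0]
    · rw [h0, Function.comp_apply, Function.comp_apply]
      have := singularValueMap_orthogonal_mul_mul (exp_smul_mem_orthogonalGroup hA t)
        (one_mem (orthogonalGroup (Fin m) ℝ)) X
      rw [Matrix.mul_one] at this
      rw [this]
  have hR : ∀ B : Matrix (Fin m) (Fin m) ℝ, Bᵀ = -B → inner ℝ Z (X * B) ≤ (0 : ℝ) := by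
    intro B hB
    have h0 : X * NormedSpace.exp ((0 : ℝ) • B) = X := by
      rw [zero_smul, NormedSpace.exp_zero, Matrix.mul_one]
    refine inner_le_zero_of_mem_frechetSubdiff (f := f ∘ singularValueMap) ?_
      (hasDerivAt_mul_exp_smul B X) fun t => ?_
    · rwa [h0]
    · rw [h0, Function.comp_apply, Function.comp_apply]
      have := singularValueMap_orthogonal_mul_mul (one_mem (orthogonalGroup (Fin n) ℝ))
        (exp_smul_mem_orthogonalGroup hB t) X
      rw [Matrix.one_mul] at this
      rw [this]
  -- The test direction is built from `X Zᵀ` itself; cyclicity of the trace turns the inner product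
  -- into the one required.
  have h1 : (X * Zᵀ)ᵀ = X * Zᵀ := by
    refine transpose_eq_of_trace_le_zero ((le_of_eq ?_).trans
      (hL ((X * Zᵀ)ᵀ - X * Zᵀ) (by simp)))
    rw [matrix_inner_def, trace_mul_comm Zᵀ, Matrix.mul_assoc _ X]
  have h2 : (Zᵀ * X)ᵀ = Zᵀ * X := by
    refine transpose_eq_of_trace_le_zero ((le_of_eq ?_).trans
      (hR ((Zᵀ * X)ᵀ - Zᵀ * X) (by simp)))
    rw [matrix_inner_def, trace_mul_comm, Matrix.mul_assoc]
  rw [transpose_mul, transpose_transpose] at h1 h2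
  obtain ⟨U, hU, V, hV, a, b, ha, hb⟩ := exists_simultaneous_svd hmn X Z h2 h1.symm
  exact ⟨⟨U, hU⟩, ⟨V, hV⟩, a, b, ha, hb⟩

/-! ### Limits and uniqueness of simultaneous decompositions -/

lemma continuous_signedPerm {m : ℕ} (π : Equiv.Perm (Fin m)) (s : Fin m → ℤˣ) :
    Continuous (signedPerm π s) :=
  (signedPermIsometry π s).continuous

lemma continuous_singularValueMap_svdEmbedding {n m : ℕ} (hmn : m ≤ n)
    (U : Matrix.orthogonalGroup (Fin n) ℝ) (V : Matrix.orthogonalGroup (Fin m) ℝ) :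
    Continuous fun x => singularValueMap (svdEmbedding hmn U V x) :=
  (continuous_singularValueMap hmn).comp (svdEmbedding hmn U V).continuous

open Matrix in
lemma norm_sq_of_mem_orthogonalGroup {k : ℕ} (U : orthogonalGroup (Fin k) ℝ) :
    ‖(U : Matrix (Fin k) (Fin k) ℝ)‖ ^ 2 = k := by
  rw [← real_inner_self_eq_norm_sq, matrix_inner_def, (mem_orthogonalGroup_iff' _ _).1 U.2]
  simp

open Matrix in
lemma tendsto_matrix_transpose {p q : ℕ} {A : ℕ → Matrix (Fin p) (Fin q) ℝ}
    {A' : Matrix (Fin p) (Fin q) ℝ} (hA : Tendsto A atTop (𝓝 A')) :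
    Tendsto (fun i => (A i)ᵀ) atTop (𝓝 A'ᵀ) :=
  (continuous_id.matrix_transpose.tendsto A').comp hA

open Matrix in
lemma tendsto_matrix_mul {p q r : ℕ} {A : ℕ → Matrix (Fin p) (Fin q) ℝ}
    {B : ℕ → Matrix (Fin q) (Fin r) ℝ} {A' : Matrix (Fin p) (Fin q) ℝ}
    {B' : Matrix (Fin q) (Fin r) ℝ} (hA : Tendsto A atTop (𝓝 A')) (hB : Tendsto B atTop (𝓝 B')) :
    Tendsto (fun i => A i * B i) atTop (𝓝 (A' * B')) :=
  ((continuous_fst.matrix_mul continuous_snd).tendsto (A', B')).comp (hA.prodMk_nhds hB)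

open Matrix in
lemma mem_orthogonalGroup_of_tendsto {k : ℕ} {U : ℕ → orthogonalGroup (Fin k) ℝ}
    {A : Matrix (Fin k) (Fin k) ℝ}
    (h : Tendsto (fun i => (U i : Matrix (Fin k) (Fin k) ℝ)) atTop (𝓝 A)) :
    A ∈ orthogonalGroup (Fin k) ℝ := by
  rw [mem_orthogonalGroup_iff]
  refine tendsto_nhds_unique (tendsto_matrix_mul h (tendsto_matrix_transpose h))
    (tendsto_const_nhds.congr fun i => ?_)
  exact ((mem_orthogonalGroup_iff _ _).1 (U i).2).symm

open Matrix in
/-- A bounded sequence of simultaneous decompositions has a convergent subsequence. -/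
lemma exists_tendsto_svdEmbedding {n m : ℕ} (hmn : m ≤ n) (U : ℕ → orthogonalGroup (Fin n) ℝ)
    (V : ℕ → orthogonalGroup (Fin m) ℝ) (a b : ℕ → EuclideanSpace ℝ (Fin m))
    {X Z : Matrix (Fin n) (Fin m) ℝ}
    (hX : Tendsto (fun i => svdEmbedding hmn (U i) (V i) (a i)) atTop (𝓝 X))
    (hZ : Tendsto (fun i => svdEmbedding hmn (U i) (V i) (b i)) atTop (𝓝 Z)) :
    ∃ φ : ℕ → ℕ, StrictMono φ ∧ ∃ U' V' a' b', Tendsto (a ∘ φ) atTop (𝓝 a') ∧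
      Tendsto (b ∘ φ) atTop (𝓝 b') ∧ X = svdEmbedding hmn U' V' a' ∧
      Z = svdEmbedding hmn U' V' b' := by
  obtain ⟨r, hr⟩ := isBounded_iff_forall_norm_le.1 (Metric.isBounded_range_of_tendsto _ hX)
  obtain ⟨s, hs⟩ := isBounded_iff_forall_norm_le.1 (Metric.isBounded_range_of_tendsto _ hZ)
  have hO : ∀ {k : ℕ} (W : orthogonalGroup (Fin k) ℝ),
      (W : Matrix (Fin k) (Fin k) ℝ) ∈ Metric.closedBall (0 : Matrix (Fin k) (Fin k) ℝ) √k :=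
    fun W => by
      rw [mem_closedBall_zero_iff]
      exact Real.le_sqrt_of_sq_le (norm_sq_of_mem_orthogonalGroup W).le
  have ha : ∀ i, a i ∈ Metric.closedBall (0 : EuclideanSpace ℝ (Fin m)) r := fun i => by
    rw [mem_closedBall_zero_iff, ← (svdEmbedding hmn (U i) (V i)).norm_map]
    exact hr _ ⟨i, rfl⟩
  have hb : ∀ i, b i ∈ Metric.closedBall (0 : EuclideanSpace ℝ (Fin m)) s := fun i => by
    rw [mem_closedBall_zero_iff, ← (svdEmbedding hmn (U i) (V i)).norm_map]
    exact hs _ ⟨i, rfl⟩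
  have hK := (isCompact_closedBall (0 : Matrix (Fin n) (Fin n) ℝ) √n).prod
    ((isCompact_closedBall (0 : Matrix (Fin m) (Fin m) ℝ) √m).prod
      ((isCompact_closedBall (0 : EuclideanSpace ℝ (Fin m)) r).prod
        (isCompact_closedBall (0 : EuclideanSpace ℝ (Fin m)) s)))
  obtain ⟨⟨A, B, a', b'⟩, -, φ, hφ, hlim⟩ := hK.tendsto_subseq
    (x := fun i => ((U i : Matrix (Fin n) (Fin n) ℝ), (V i : Matrix (Fin m) (Fin m) ℝ), a i, b i))
    fun i => ⟨hO _, hO _, ha i, hb i⟩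
  have hA := hlim.fst_nhds
  have hB := hlim.snd_nhds.fst_nhds
  have ha' := hlim.snd_nhds.snd_nhds.fst_nhds
  have hb' := hlim.snd_nhds.snd_nhds.snd_nhds
  have hAO := mem_orthogonalGroup_of_tendsto (U := U ∘ φ) hA
  have hBO := mem_orthogonalGroup_of_tendsto (U := V ∘ φ) hB
  have hD : Continuous (rectDiag n : EuclideanSpace ℝ (Fin m) → Matrix (Fin n) (Fin m) ℝ) := by
    refine (svdEmbedding hmn 1 1).continuous.congr fun x => ?_
    rw [svdEmbedding_apply]
    simp
  have hlim' : ∀ {c : ℕ → EuclideanSpace ℝ (Fin m)} {c'}, Tendsto c atTop (𝓝 c') →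
      Tendsto (fun i => svdEmbedding hmn (U (φ i)) (V (φ i)) (c i)) atTop
        (𝓝 (svdEmbedding hmn ⟨A, hAO⟩ ⟨B, hBO⟩ c')) := fun hc =>
    tendsto_matrix_mul (tendsto_matrix_mul (tendsto_matrix_transpose hA)
      ((hD.tendsto _).comp hc)) hB
  exact ⟨φ, hφ, ⟨A, hAO⟩, ⟨B, hBO⟩, a', b', ha', hb',
    tendsto_nhds_unique (hX.comp hφ.tendsto_atTop) (hlim' ha'),
    tendsto_nhds_unique (hZ.comp hφ.tendsto_atTop) (hlim' hb')⟩

/-- A signed permutation that sorts both `x` and a small perturbation of `x` along `v`. -/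
lemma exists_signedPerm_sorting_perturbation {n m : ℕ} (hmn : m ≤ n)
    (U : Matrix.orthogonalGroup (Fin n) ℝ) (V : Matrix.orthogonalGroup (Fin m) ℝ)
    (x v : EuclideanSpace ℝ (Fin m)) :
    ∃ π s, ∃ δ : ℝ, 0 < δ ∧ singularValueMap (svdEmbedding hmn U V x) = signedPerm π s x ∧
      singularValueMap (svdEmbedding hmn U V (x + δ • v)) = signedPerm π s (x + δ • v) := by
  -- There are finitely many signed permutations. One that fails to sort `x` fails for all small `δ`
  -- by continuity, and one that sorts `x` fails for every `δ > 0` by assumption; so for small `δ >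
  -- 0` none sorts `x + δ v`, which is absurd.
  by_contra! h
  have hc : Continuous fun δ : ℝ => x + δ • v := by fun_prop
  have key : ∀ p : Equiv.Perm (Fin m) × (Fin m → ℤˣ), ∀ᶠ δ : ℝ in 𝓝[>] 0,
      singularValueMap (svdEmbedding hmn U V (x + δ • v)) ≠ signedPerm p.1 p.2 (x + δ • v) := by
    intro p
    by_cases hp : singularValueMap (svdEmbedding hmn U V x) = signedPerm p.1 p.2 x
    · filter_upwards [self_mem_nhdsWithin] with δ hδ using h p.1 p.2 δ hδ hp
    · have h1 := ((continuous_singularValueMap_svdEmbedding hmn U V).comp hc).tendsto (0 : ℝ)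
      have h2 := ((continuous_signedPerm p.1 p.2).comp hc).tendsto (0 : ℝ)
      refine ((h1.prodMk_nhds h2).mono_left nhdsWithin_le_nhds).eventually
        (isClosed_diagonal.isOpen_compl.mem_nhds ?_)
      simpa using hp
  obtain ⟨δ, hδ⟩ := (eventually_all.2 key).exists
  obtain ⟨π, s, hπ⟩ := exists_singularValueMap_svdEmbedding hmn U V (x + δ • v)
  exact hδ (π, s) hπ

/-- If `σ (Diag (x + t v)) = σ (Diag (a + t b))` for all `t`, then `(x, v)` and `(a, b)` are
conjugate by signed permutations. -/
lemma exists_signedPerm_eq_of_svdEmbedding_eq {n m : ℕ} (hmn : m ≤ n)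
    {U U' : Matrix.orthogonalGroup (Fin n) ℝ} {V V' : Matrix.orthogonalGroup (Fin m) ℝ}
    {x v a b : EuclideanSpace ℝ (Fin m)}
    (hx : svdEmbedding hmn U V x = svdEmbedding hmn U' V' a)
    (hv : svdEmbedding hmn U V v = svdEmbedding hmn U' V' b) :
    ∃ (π : Equiv.Perm (Fin m)) (s : Fin m → ℤˣ) (ρ : Equiv.Perm (Fin m)) (r : Fin m → ℤˣ),
      signedPerm π s x = signedPerm ρ r a ∧ signedPerm π s v = signedPerm ρ r b := by
  have h1 : ∀ t : ℕ, ∃ p : (Equiv.Perm (Fin m) × (Fin m → ℤˣ)) ×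
      (Equiv.Perm (Fin m) × (Fin m → ℤˣ)), signedPermIsometry p.1.1 p.1.2 (x + (t : ℝ) • v) =
        signedPermIsometry p.2.1 p.2.2 (a + (t : ℝ) • b) := by
    intro t
    obtain ⟨π, s, h⟩ := exists_singularValueMap_svdEmbedding hmn U V (x + (t : ℝ) • v)
    obtain ⟨ρ, r, h'⟩ := exists_singularValueMap_svdEmbedding hmn U' V' (a + (t : ℝ) • b)
    refine ⟨((π, s), (ρ, r)), ?_⟩
    rw [signedPermIsometry_apply, signedPermIsometry_apply, ← h, ← h', map_add, map_add, map_smul,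
      map_smul, hx, hv]
  choose p hp using h1
  -- Pigeonhole: some pair of signed permutations serves two different times, and two points on a
  -- line determine its direction and its base point.
  obtain ⟨t, t', htt, hpt⟩ := Finite.exists_ne_map_eq_of_infinite p
  have e1 := hp t
  have e2 := hp t'
  rw [← hpt] at e2
  simp only [map_add, map_smul] at e1 e2
  have htt' : (t : ℝ) - t' ≠ 0 := sub_ne_zero.2 (by exact_mod_cast htt)
  have e3 : signedPermIsometry (p t).1.1 (p t).1.2 v = signedPermIsometry (p t).2.1 (p t).2.2 b := by
    refine smul_right_injective _ htt' ?_
    simp only [sub_smul]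
    calc _ = (signedPermIsometry (p t).1.1 (p t).1.2 x +
          (t : ℝ) • signedPermIsometry (p t).1.1 (p t).1.2 v) -
          (signedPermIsometry (p t).1.1 (p t).1.2 x +
          (t' : ℝ) • signedPermIsometry (p t).1.1 (p t).1.2 v) := by abel
      _ = _ := by rw [e1, e2]; abel
  rw [e3] at e1
  exact ⟨_, _, _, _, add_right_cancel e1, e3⟩

/-! ### Transfer for globally invariant functions and sets -/

section Invariant

variable {n m : ℕ} (hmn : m ≤ n) {f : EuclideanSpace ℝ (Fin m) → EReal}
  (hf : ∀ π s y, f (signedPerm π s y) = f y)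

include hf in
lemma apply_singularValueMap_svdEmbedding (U : Matrix.orthogonalGroup (Fin n) ℝ)
    (V : Matrix.orthogonalGroup (Fin m) ℝ) (y : EuclideanSpace ℝ (Fin m)) :
    f (singularValueMap (svdEmbedding hmn U V y)) = f y := by
  obtain ⟨π, s, h⟩ := exists_singularValueMap_svdEmbedding hmn U V y
  rw [h, hf]

include hf in
/-- Fréchet subgradients of an absolutely permutation-invariant function lift to matrices. -/
theorem svdEmbedding_mem_frechetSubdiff (U : Matrix.orthogonalGroup (Fin n) ℝ)
    (V : Matrix.orthogonalGroup (Fin m) ℝ) {x v : EuclideanSpace ℝ (Fin m)}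
    (h : v ∈ frechetSubdiff f x) :
    svdEmbedding hmn U V v ∈
      frechetSubdiff (f ∘ singularValueMap) (svdEmbedding hmn U V x) := by
  obtain ⟨h1, h2, h3⟩ := h
  have hx := apply_singularValueMap_svdEmbedding hmn hf U V x
  obtain ⟨π, s, δ, hδ, hs, hsδ⟩ := exists_signedPerm_sorting_perturbation hmn U V x v
  set τ := signedPermIsometry π s
  set L := svdEmbedding hmn U V
  refine ⟨by rwa [Function.comp_apply, hx], by rwa [Function.comp_apply, hx], fun ε hε => ?_⟩
  have hlim : Tendsto (fun Y => τ.symm (singularValueMap Y)) (𝓝 (L x)) (𝓝 x) := by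
    have := (τ.symm.continuous.comp (continuous_singularValueMap hmn)).tendsto (L x)
    rwa [Function.comp_apply, hs, ← signedPermIsometry_apply, τ.symm_apply_apply] at this
  -- Half of `ε` pays for the subgradient inequality at `y`. The other half pays for the quadratic
  -- error `‖Y - L x‖² / (2 δ)`, at most `(ε / 2) ‖Y - L x‖` on the ball of radius `δ ε`.
  filter_upwards [hlim.eventually (h3 (ε / 2) (half_pos hε)),
    Metric.closedBall_mem_nhds (L x) (mul_pos hδ hε)] with Y hY hYball
  rw [mem_closedBall_iff_norm] at hYball
  set y := τ.symm (singularValueMap Y) with hy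
  have hτy : τ y = singularValueMap Y := τ.apply_symm_apply _
  have hfy : f (singularValueMap Y) = f y := by
    rw [← hτy]
    exact hf π s y
  rw [Function.comp_apply, Function.comp_apply, hx, hfy]
  refine le_trans (add_le_add_right (EReal.coe_le_coe_iff.2 ?_) _) hY
  have hs' : singularValueMap (L x) = τ x := hs
  have hsδ' : singularValueMap (L (x + δ • v)) = τ (x + δ • v) := hsδ
  have hnorm : ‖y - x‖ ≤ ‖Y - L x‖ := by
    rw [← τ.norm_map, map_sub, hτy, ← hs']
    exact norm_singularValueMap_sub_le hmn _ _
  -- Since `τ` sorts `x + δ v`, the trace inequality bounds `⟪L (x + δ v), Y⟫` by `⟪x + δ v, y⟫`.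
  -- The defect `⟪x, y⟫ - ⟪L x, Y⟫` is of second order, so dividing by `δ` isolates `v`.
  have hvn := inner_le_inner_singularValueMap hmn (L (x + δ • v)) Y
  rw [hsδ', ← hτy, τ.inner_map_map, map_add, map_smul, inner_add_left, inner_add_left,
    real_inner_smul_left, real_inner_smul_left] at hvn
  have hsq := inner_singularValueMap_sub_inner hmn (L x) Y
  rw [hs', ← hτy, τ.inner_map_map] at hsq
  have e1 : inner ℝ (L v) (Y - L x) = inner ℝ (L v) Y - inner ℝ v x := by
    rw [inner_sub_right, L.inner_map_map]
  have e2 : inner ℝ v (y - x) = inner ℝ v y - inner ℝ v x := inner_sub_right _ _ _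
  have hquad : ‖Y - L x‖ ^ 2 ≤ δ * ε * ‖Y - L x‖ := by
    rw [sq]
    exact mul_le_mul_of_nonneg_right hYball (norm_nonneg _)
  have hfin : δ * (inner ℝ (L v) Y - inner ℝ v y) ≤ δ * (ε / 2 * ‖Y - L x‖) := by
    nlinarith [sq_nonneg ‖τ y - τ x‖]
  have hfin' := le_of_mul_le_mul_left hfin hδ
  rw [e1, e2]
  nlinarith

include hf in
theorem svdEmbedding_mem_limitingSubdiff (U : Matrix.orthogonalGroup (Fin n) ℝ)
    (V : Matrix.orthogonalGroup (Fin m) ℝ) {x v : EuclideanSpace ℝ (Fin m)}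
    (h : v ∈ limitingSubdiff f x) :
    svdEmbedding hmn U V v ∈
      limitingSubdiff (f ∘ singularValueMap) (svdEmbedding hmn U V x) := by
  obtain ⟨h1, h2, xs, vs, hv, hx, hfx, hvs⟩ := h
  have hL := apply_singularValueMap_svdEmbedding hmn hf U V
  refine ⟨by rwa [Function.comp_apply, hL], by rwa [Function.comp_apply, hL],
    fun i => svdEmbedding hmn U V (xs i), fun i => svdEmbedding hmn U V (vs i),
    fun i => svdEmbedding_mem_frechetSubdiff hmn hf U V (hv i),
    ((svdEmbedding hmn U V).continuous.tendsto _).comp hx, ?_,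
    ((svdEmbedding hmn U V).continuous.tendsto _).comp hvs⟩
  simpa only [Function.comp_apply, hL] using hfx

include hf in
/-- Limiting subgradients of `f ∘ σ` are diagonalized, simultaneously with the base point, to
limiting subgradients of `f`. -/
theorem exists_svdEmbedding_of_mem_limitingSubdiff {X Z : Matrix (Fin n) (Fin m) ℝ}
    (h : Z ∈ limitingSubdiff (f ∘ singularValueMap) X) :
    ∃ U V a b, X = svdEmbedding hmn U V a ∧ Z = svdEmbedding hmn U V b ∧
      b ∈ limitingSubdiff f a := by
  obtain ⟨h1, h2, xs, vs, hv, hx, hfx, hvs⟩ := h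
  choose U V a b hxa hvb using fun i => exists_svdEmbedding_of_mem_frechetSubdiff hmn (hv i)
  have hL := fun U V => apply_singularValueMap_svdEmbedding (n := n) hmn hf U V
  obtain ⟨φ, hφ, U', V', a', b', ha, hb, rfl, rfl⟩ := exists_tendsto_svdEmbedding hmn U V a b
    (hx.congr hxa) (hvs.congr hvb)
  simp only [Function.comp_apply, hL] at h1 h2 hfx
  refine ⟨U', V', a', b', rfl, rfl, h1, h2, a ∘ φ, b ∘ φ, fun i => ?_, ha, ?_, hb⟩
  · refine mem_frechetSubdiff_of_isometry (svdEmbedding hmn (U (φ i)) (V (φ i)))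
      (g := f ∘ singularValueMap) (hL (U (φ i)) (V (φ i))) ?_
    simpa only [Function.comp_apply, ← hxa, ← hvb] using hv (φ i)
  · refine (hfx.comp hφ.tendsto_atTop).congr fun i => ?_
    simp only [Function.comp_apply]
    rw [hxa, hL]

include hf in
/-- Identifiability transfers between an absolutely permutation-invariant function and its
composition with the singular value map. -/
theorem isIdentifiableAt_comp_singularValueMap_iff {M : Set (EuclideanSpace ℝ (Fin m))}
    (hM : ∀ π s y, signedPerm π s y ∈ M ↔ y ∈ M) (U : Matrix.orthogonalGroup (Fin n) ℝ)
    (V : Matrix.orthogonalGroup (Fin m) ℝ) (x v : EuclideanSpace ℝ (Fin m)) :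
    IsIdentifiableAt f M x v ↔ IsIdentifiableAt (f ∘ singularValueMap) (singularValueMap ⁻¹' M)
      (svdEmbedding hmn U V x) (svdEmbedding hmn U V v) := by
  have hL := fun U V => apply_singularValueMap_svdEmbedding (n := n) hmn hf U V
  have hML : ∀ (U : Matrix.orthogonalGroup (Fin n) ℝ) (V : Matrix.orthogonalGroup (Fin m) ℝ) y,
      singularValueMap (svdEmbedding hmn U V y) ∈ M ↔ y ∈ M := fun U V y => by
    obtain ⟨π, s, h⟩ := exists_singularValueMap_svdEmbedding hmn U V y
    rw [h, hM]
  -- Any other simultaneous decomposition of the pair is matched to `(x, v)` by a symmetry of `f`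
  -- and `M`.
  have hconj : ∀ {U' V' a b}, svdEmbedding hmn U V x = svdEmbedding hmn U' V' a →
      svdEmbedding hmn U V v = svdEmbedding hmn U' V' b →
      ∃ T : EuclideanSpace ℝ (Fin m) ≃ₗᵢ[ℝ] EuclideanSpace ℝ (Fin m),
        (∀ y, f (T y) = f y) ∧ (∀ y, T y ∈ M ↔ y ∈ M) ∧ T a = x ∧ T b = v := by
    intro U' V' a b hxa hvb
    obtain ⟨π, s, ρ, r, h1, h2⟩ := exists_signedPerm_eq_of_svdEmbedding_eq hmn hxa hvb
    have hT : ∀ y, signedPerm π s ((signedPermIsometry π s).symm (signedPerm ρ r y)) =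
        signedPerm ρ r y := fun y => (signedPermIsometry π s).apply_symm_apply _
    refine ⟨(signedPermIsometry ρ r).trans (signedPermIsometry π s).symm, fun y => ?_, fun y => ?_,
      ?_, ?_⟩ <;> rw [LinearIsometryEquiv.trans_apply, signedPermIsometry_apply]
    · rw [← hf π s, hT, hf]
    · rw [← hM π s, hT, hM]
    · rw [← h1, ← signedPermIsometry_apply, LinearIsometryEquiv.symm_apply_apply]
    · rw [← h2, ← signedPermIsometry_apply, LinearIsometryEquiv.symm_apply_apply]
  constructor
  · intro H
    refine ⟨fun X hX => H.subset_domain hX,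
      svdEmbedding_mem_limitingSubdiff hmn hf U V H.mem_subdiff, fun xs vs hv hx hfx hvs => ?_⟩
    by_contra hcon
    -- Along a subsequence that avoids the set, a further subsequence of decompositions converges. A
    -- symmetry moves its limit to `(x, v)`, where identifiability of `M` gives a contradiction.
    obtain ⟨ψ, hψ, hψM⟩ := extraction_of_frequently_atTop (not_eventually.1 hcon)
    choose U' V' a b hxa hvb hab using
      fun i => exists_svdEmbedding_of_mem_limitingSubdiff hmn hf (hv (ψ i))
    obtain ⟨φ, hφ, U'', V'', a', b', ha, hb, hX, hZ⟩ := exists_tendsto_svdEmbedding hmn U' V' a b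
      ((hx.comp hψ.tendsto_atTop).congr hxa) ((hvs.comp hψ.tendsto_atTop).congr hvb)
    obtain ⟨T, hTf, hTM, rfl, rfl⟩ := hconj hX hZ
    have hev := H.eventually_mem (fun i => T (a (φ i))) (fun i => T (b (φ i)))
      (fun i => mem_limitingSubdiff_isometryEquiv T hTf (hab _))
      ((T.continuous.tendsto _).comp ha) ?_ ((T.continuous.tendsto _).comp hb)
    · obtain ⟨i, hi⟩ := hev.exists
      refine hψM (φ i) ?_
      rw [Set.mem_preimage, hxa, hML]
      exact (hTM _).1 hi
    · simp only [Function.comp_apply, hL] at hfx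
      refine ((hfx.comp hψ.tendsto_atTop).comp hφ.tendsto_atTop).congr fun i => ?_
      simp only [Function.comp_apply]
      rw [hxa, hL, hTf]
  · intro H
    refine ⟨fun y hy => ?_, ?_, fun xs vs hv hx hfx hvs => ?_⟩
    · have : f (singularValueMap (svdEmbedding hmn U V y)) < ⊤ :=
        H.subset_domain ((hML U V y).2 hy)
      rwa [hL] at this
    · obtain ⟨U', V', a, b, hX, hZ, hab⟩ :=
        exists_svdEmbedding_of_mem_limitingSubdiff hmn hf H.mem_subdiff
      obtain ⟨T, hTf, -, rfl, rfl⟩ := hconj hX hZ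
      exact mem_limitingSubdiff_isometryEquiv T hTf hab
    · have hev := H.eventually_mem (fun i => svdEmbedding hmn U V (xs i))
        (fun i => svdEmbedding hmn U V (vs i))
        (fun i => svdEmbedding_mem_limitingSubdiff hmn hf U V (hv i))
        (((svdEmbedding hmn U V).continuous.tendsto _).comp hx)
        (by simpa only [Function.comp_apply, hL] using hfx)
        (((svdEmbedding hmn U V).continuous.tendsto _).comp hvs)
      exact hev.mono fun i hi => (hML U V _).1 hi

end Invariant

/-! ### From local to global invariance -/

/-- The coefficients of a decomposition of `X` and their signed permutation `σ(X)` have the same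
rearrangement, so sorting `σ(X)` again changes nothing. -/
lemma singularValueMap_rectDiag_singularValueMap {n m : ℕ} (hmn : m ≤ n)
    (X : Matrix (Fin n) (Fin m) ℝ) :
    singularValueMap (rectDiag n (singularValueMap X)) = singularValueMap X := by
  obtain ⟨U, V, a, rfl⟩ := exists_svdEmbedding_eq hmn X
  obtain ⟨π, s, h⟩ := exists_singularValueMap_svdEmbedding hmn U V a
  rw [h, singularValueMap_rectDiag_signedPerm hmn, ← h, singularValueMap_svdEmbedding]

/-- Near a point that is its own rearrangement, the signed permutations that sort nearby points
fix that point. -/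
lemma eventually_signedPerm_fixes {n m : ℕ} (hmn : m ≤ n) {x₀ : EuclideanSpace ℝ (Fin m)}
    (hx₀ : singularValueMap (rectDiag n x₀) = x₀) {P : (EuclideanSpace ℝ (Fin m)) →
      (EuclideanSpace ℝ (Fin m)) → Prop}
    (hP : ∀ π s, signedPerm π s x₀ = x₀ → ∀ᶠ x in 𝓝 x₀, P (signedPerm π s x) x) :
    ∀ᶠ x in 𝓝 x₀, P (singularValueMap (rectDiag n x)) x := by
  have hσ : ∀ x : EuclideanSpace ℝ (Fin m),
      singularValueMap (svdEmbedding hmn 1 1 x) = singularValueMap (rectDiag n x) :=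
    singularValueMap_svdEmbedding hmn 1 1
  have hcont : Continuous fun x : EuclideanSpace ℝ (Fin m) => singularValueMap (rectDiag n x) :=
    (continuous_singularValueMap_svdEmbedding hmn 1 1).congr hσ
  have key : ∀ p : Equiv.Perm (Fin m) × (Fin m → ℤˣ), ∀ᶠ x in 𝓝 x₀,
      singularValueMap (rectDiag n x) = signedPerm p.1 p.2 x → P (signedPerm p.1 p.2 x) x := by
    intro p
    -- If `p` moves `x₀`, then sorting and `p` already disagree at `x₀`, hence on a neighbourhood,
    -- and the implication is vacuous there.
    by_cases hp : signedPerm p.1 p.2 x₀ = x₀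
    · exact (hP _ _ hp).mono fun x hx _ => hx
    · have hne : ∀ᶠ x in 𝓝 x₀, singularValueMap (rectDiag n x) ≠ signedPerm p.1 p.2 x := by
        refine ((hcont.tendsto x₀).prodMk_nhds ((continuous_signedPerm p.1 p.2).tendsto
          x₀)).eventually (isClosed_diagonal.isOpen_compl.mem_nhds ?_)
        rw [hx₀]
        exact fun h => hp h.symm
      exact hne.mono fun x hx h => absurd h hx
  filter_upwards [eventually_all.2 key] with x hx
  obtain ⟨π, s, h⟩ := exists_singularValueMap_rectDiag hmn x
  rw [h]
  exact hx (π, s) h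

theorem mainTheorem11 {n m : ℕ} (hmn : m ≤ n)
    (f : EuclideanSpace ℝ (Fin m) → EReal) (hf : LowerSemicontinuous f)
    (X₀ : Matrix (Fin n) (Fin m) ℝ)
    (hfinv : LocallyAbsPermInvariant f (singularValueMap X₀))
    (M : Set (EuclideanSpace ℝ (Fin m))) (hMdom : M ⊆ effDomain f)
    (hMinv : SetLocallyAbsPermInvariant M (singularValueMap X₀))
    (v₀ : EuclideanSpace ℝ (Fin m))
    (U : Matrix (Fin n) (Fin n) ℝ) (hU : U ∈ Matrix.orthogonalGroup (Fin n) ℝ)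
    (V : Matrix (Fin m) (Fin m) ℝ) (hV : V ∈ Matrix.orthogonalGroup (Fin m) ℝ)
    (hUV : X₀ = U.transpose * rectDiag n (singularValueMap X₀) * V) :
    IsIdentifiableAt f M (singularValueMap X₀) v₀ ↔
      IsIdentifiableAt (f ∘ singularValueMap) (singularValueMap ⁻¹' M) X₀
        (U.transpose * rectDiag n v₀ * V) := by
  set x₀ := singularValueMap X₀
  have hx₀ : singularValueMap (rectDiag n x₀) = x₀ :=
    singularValueMap_rectDiag_singularValueMap hmn X₀
  let g : EuclideanSpace ℝ (Fin m) → EuclideanSpace ℝ (Fin m) :=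
    fun x => singularValueMap (rectDiag n x)
  have hfg : f =ᶠ[𝓝 x₀] f ∘ g :=
    (eventually_signedPerm_fixes hmn hx₀ (P := fun y x => f y = f x) hfinv).mono
      fun x hx => hx.symm
  have hMg : ∀ᶠ x in 𝓝 x₀, x ∈ M ↔ x ∈ g ⁻¹' M :=
    (eventually_signedPerm_fixes hmn hx₀ (P := fun y x => y ∈ M ↔ x ∈ M) hMinv).mono
      fun x hx => hx.symm
  have hlocal : IsIdentifiableAt f M x₀ v₀ ↔ IsIdentifiableAt (f ∘ g) (g ⁻¹' M) x₀ v₀ :=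
    ⟨fun H => H.congr hfg hMg fun x hx => hMdom hx,
      fun H => H.congr hfg.symm (hMg.mono fun x hx => hx.symm) hMdom⟩
  -- This identity holds everywhere, so on the matrix side the function and the set are literally
  -- unchanged and no localization is needed.
  have hgσ : g ∘ singularValueMap = (singularValueMap : Matrix (Fin n) (Fin m) ℝ → _) :=
    funext fun X => singularValueMap_rectDiag_singularValueMap hmn X
  have hgp : ∀ π s y, g (signedPerm π s y) = g y := singularValueMap_rectDiag_signedPerm hmn
  have hmain := isIdentifiableAt_comp_singularValueMap_iff hmn (f := f ∘ g) (M := g ⁻¹' M)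
    (fun π s y => by simp only [Function.comp_apply, hgp])
    (fun π s y => by simp only [Set.mem_preimage, hgp]) ⟨U, hU⟩ ⟨V, hV⟩ x₀ v₀
  rw [Function.comp_assoc, ← Set.preimage_comp, hgσ, svdEmbedding_apply, svdEmbedding_apply,
    ← hUV] at hmain
  exact hlocal.trans hmain
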